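/- Write $[n]=\{1,\dots,n\}$ and identify distributions on $[n]$ with their probability mass functions. For $k\ge 1$, a $k$-segmentation of $[n]$ consists of $k$ disjoint, possibly empty, intervals $I_1,\dots,I_k$ covering $[n]$; a function on $[n]$ is $k$-flat (on that segmentation) if it is constant on each $I_i$, and a $k$-flat distribution is a distribution that is a $k$-flat function. Two functions are $\epsilon$-close if their $\ell_1$-distance is less than $\epsilon$, and $\epsilon$-far otherwise. Let $q$ be a known distribution on $[n]$, $k\ge 1$ and $0<\epsilon\le 2$. Given independent samples from an unknown distribution $p$ on $[n]$, consider the following algorithm, with absolute constants $C_1,C_2>0$. 1. Put $\epsilon'=\epsilon/14$, $\eta=\epsilon'/4$, $v=\lceil \log(n/\eta^2)/\log(1+\eta)\rceil+1$, $t=kv$. The buckets are $B_1=\{x: q(x)\le \eta^2/n\}$ and $B_j=\{x:(1+\eta)^{j-2}\eta^2/n<q(x)\le(1+\eta)^{j-1}\eta^2/n\}$ for $2\le j\le v$. 2. Draw $s=Rm$ samples, in $R=\lceil C_1\log(4n/\epsilon)\rceil$ batches of $m=\lceil C_2\sqrt{nt}/\epsilon^3\rceil$; let $\hat p$ be the empirical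 distribution of all $s$ samples. 3. For every $k$-segmentation $I_1,\dots,I_k$: let $\mathcal D$ be the partition of $[n]$ into the sets $I_i\cap B_j$, where each such set of size $z>\lceil n/t\rceil$ is further split into $\lfloor zt/n\rfloor+1$ runs of consecutive elements of the set, of roughly equal size (the element preceded by exactly $a$ elements of the set goes to run number $\lfloor aL/z\rfloor$, where $L=\lfloor zt/n\rfloor+1$). The segmentation passes if both of the following hold. (a) For every $D\in\mathcal D$ that contains at least $\epsilon' s/(4t)$ of the samples, at most half of the batches have a collision estimate at least $(2\epsilon')^2/|D|$. Here the collision estimate of a batch is the fraction of coinciding pairs among all pairs of its samples that lie in $D$ (read as $0$ if there is no pair), minus $1/|D|$; it estimates the squared $\ell_2$-distance between $p$ conditioned on $D$ and the uniform distribution on $D$. (b) For some $\alpha\in\{0,\epsilon'/2,\epsilon',\dots,1\}$ there is a nonnegative function $f$, constant on each $I_i$, such that $\sum_{D\in\mathcal D}|\hat p(D)-(1-\alpha)q(D)-\alpha f(D)|<2\epsilon'$. 4. Accept if some $k$-segmentation passes; otherwise reject. Theorem. There are absolute constants $C_1,C_2,C>0$ and $c\in\mathbb N$ such that, for all $n$,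 $k\ge1$, $0<\epsilon\le2$ and all distributions $q$ on $[n]$, this algorithm is an identity tester in the presence of $k$-flat noise: for every distribution $p$ on $[n]$, - if $p=(1-\alpha)q+\alpha r$ for some $\alpha\in[0,1]$ and some $k$-flat distribution $r$, then it accepts with probability at least $2/3$; - if $p$ is $\epsilon$-far from $(1-\alpha)q+\alpha r$ for every $\alpha\in[0,1]$ and every $k$-flat distribution $r$, then it rejects with probability at least $2/3$; and the number $s$ of samples that it uses is $\widetilde O(\sqrt{nk}/\epsilon^{3.5})$, namely $$ s\le C\,\frac{\sqrt{nk}}{\epsilon^{3.5}}\,\bigl(\log(4n/\epsilon)\bigr)^{c}. $$ -/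

import Mathlib

noncomputable section

open scoped Classical

namespace KFlat

/-! ### The testing problem -/

/-- A `k`-segmentation of `[n]`: `k` pairwise disjoint (possibly empty) intervals that cover
`[n]`. -/
structure Segmentation (n k : ℕ) where
  part : Fin k → Finset (Fin n)
  ordConnected : ∀ i, Set.OrdConnected (part i : Set (Fin n))
  disjoint : ∀ i j, i ≠ j → Disjoint (part i) (part j)
  cover : ∀ x, ∃ i, x ∈ part i

/-- `f` is constant on every interval of the segmentation `I`. -/
def Segmentation.IsFlatOn {n k : ℕ} (I : Segmentation n k) (f : Fin n → ℝ) : Prop :=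
  ∀ i, ∀ x ∈ I.part i, ∀ y ∈ I.part i, f x = f y

/-- `k`-flat functions on `[n]`. -/
def IsFlat {n : ℕ} (k : ℕ) (f : Fin n → ℝ) : Prop :=
  ∃ I : Segmentation n k, I.IsFlatOn f

/-- `r` is (the probability mass function of) a `k`-flat distribution. -/
def IsFlatDist {n : ℕ} (k : ℕ) (r : Fin n → ℝ) : Prop :=
  r ∈ stdSimplex ℝ (Fin n) ∧ IsFlat k r

/-- The mixture `(1 - α) q + α r`. -/
def mixture {n : ℕ} (α : ℝ) (q r : Fin n → ℝ) : Fin n → ℝ :=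
  fun x => (1 - α) * q x + α * r x

/-- The `ℓ₁`-distance. -/
def l1Dist {n : ℕ} (f g : Fin n → ℝ) : ℝ := ∑ x, |f x - g x|

/-- `p` is a mixture of `q` and some `k`-flat distribution. -/
def IsMixtureWithFlat {n : ℕ} (k : ℕ) (q p : Fin n → ℝ) : Prop :=
  ∃ r, IsFlatDist k r ∧ ∃ α ∈ Set.Icc (0 : ℝ) 1, p = mixture α q r

/-- `p` is `ε`-far from every mixture of `q` and a `k`-flat distribution. -/
def IsFarFromMixtures {n : ℕ} (k : ℕ) (ε : ℝ) (q p : Fin n → ℝ) : Prop :=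
  ∀ r, IsFlatDist k r → ∀ α ∈ Set.Icc (0 : ℝ) 1, ε ≤ l1Dist p (mixture α q r)

/-- The probability of the event `E` when `s` independent samples are drawn from `p`. -/
def sampleProb {n : ℕ} (p : Fin n → ℝ) (s : ℕ) (E : (Fin s → Fin n) → Prop) : ℝ :=
  ∑ x : Fin s → Fin n, if E x then ∏ i, p (x i) else 0

/-- The decision rule `accept`, applied to `s` independent samples of an unknown distribution,
is an identity tester for `q` in the presence of `k`-flat noise with proximity parameter `ε`. -/
def IsFlatNoiseIdentityTester {n : ℕ} (k : ℕ) (ε : ℝ) (q : Fin n → ℝ) (s : ℕ)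
    (accept : (Fin s → Fin n) → Prop) : Prop :=
  ∀ p ∈ stdSimplex ℝ (Fin n),
    (IsMixtureWithFlat k q p → 2 / 3 ≤ sampleProb p s accept) ∧
    (IsFarFromMixtures k ε q p → 2 / 3 ≤ sampleProb p s fun x => ¬ accept x)

/-! ### Partitions of the domain -/

/-- The number `v` of buckets: `(1 + η) ^ (v - 1) * η ^ 2 / n ≥ 1`, so that every value
`q x ≤ 1` falls into one of the `v` buckets. -/
def numBuckets (n : ℕ) (η : ℝ) : ℕ :=
  ⌈Real.log (n / η ^ 2) / Real.log (1 + η)⌉₊ + 1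

/-- The buckets of `[n]` with respect to `q`, numbered from `0`. -/
def bucket {n : ℕ} (q : Fin n → ℝ) (η : ℝ) : ℕ → Finset (Fin n)
  | 0 => {x | q x ≤ η ^ 2 / n}
  | j + 1 => {x | (1 + η) ^ j * η ^ 2 / n < q x ∧ q x ≤ (1 + η) ^ (j + 1) * η ^ 2 / n}

/-- The number of pieces into which a set of size `z` is split. -/
def numPieces (n t z : ℕ) : ℕ :=
  if ⌈(n : ℝ) / t⌉₊ < z then z * t / n + 1 else 1

/-- The `l`-th piece of `S`, when `S` is split into `numPieces n t S.card` runs of consecutive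
elements of `S` of roughly the same size: the element of rank `a` in `S` goes to the piece
`⌊a * numPieces n t S.card / S.card⌋`. -/
def piece {n : ℕ} (t : ℕ) (S : Finset (Fin n)) (l : ℕ) : Finset (Fin n) :=
  {x ∈ S | (Finset.card {y ∈ S | y < x}) * numPieces n t S.card / S.card = l}

/-- The refined division: every intersection of an interval of `I` with a bucket is split into
pieces of size at most `⌈n / t⌉`, where `t = k * v` and `v` is the number of buckets. -/
def refinedDivision {n k : ℕ} (I : Segmentation n k) (q : Fin n → ℝ) (η : ℝ) :
    Finset (Finset (Fin n)) :=
  Finset.univ.biUnion fun i : Fin k =>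
    (Finset.range (numBuckets n η)).biUnion fun j =>
      (Finset.range (numPieces n (k * numBuckets n η) (I.part i ∩ bucket q η j).card)).image
        (piece (k * numBuckets n η) (I.part i ∩ bucket q η j))

/-- The `ℓ₁`-distance between the coarsenings of `f` and `g` over the sets in `𝒟`. -/
def coarseDist {n : ℕ} (𝒟 : Finset (Finset (Fin n))) (f g : Fin n → ℝ) : ℝ :=
  ∑ D ∈ 𝒟, |(∑ x ∈ D, f x) - (∑ x ∈ D, g x)|

/-! ### The algorithm -/

/-- The number of samples that fall into `D`. -/
def countIn {n s : ℕ} (x : Fin s → Fin n) (D : Finset (Fin n)) : ℕ :=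
  Finset.card {i : Fin s | x i ∈ D}

/-- The empirical distribution of the samples `x`. -/
def empirical {n s : ℕ} (x : Fin s → Fin n) : Fin n → ℝ :=
  fun a => (countIn x {a} : ℝ) / s

/-- The number of pairs of samples in `D` that coincide. -/
def collisions {n m : ℕ} (y : Fin m → Fin n) (D : Finset (Fin n)) : ℕ :=
  Finset.card {ij : Fin m × Fin m | ij.1 < ij.2 ∧ y ij.1 = y ij.2 ∧ y ij.1 ∈ D}

/-- The collision estimate of the squared `ℓ₂`-distance, on `D`, between the conditional
distribution of the samples in `D` and the uniform distribution: the fraction of colliding pairs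
(read as `0` if there are no pairs) minus `1 / |D|`. -/
def l2SqEstimate {n m : ℕ} (y : Fin m → Fin n) (D : Finset (Fin n)) : ℝ :=
  (collisions y D : ℝ) / ((countIn y D).choose 2 : ℝ) - 1 / (D.card : ℝ)

/-- The `b`-th of `R` batches of `m` samples each. -/
def batch {n R m : ℕ} (x : Fin (R * m) → Fin n) (b : Fin R) : Fin m → Fin n :=
  fun i => x (finProdFinEquiv (b, i))

/-- In more than half of the batches, the estimated `ℓ₂`-distance to uniform on `D` is at least
`2 ε' / √|D|`. -/
def LooksNonuniform {n R m : ℕ} (ε' : ℝ) (x : Fin (R * m) → Fin n) (D : Finset (Fin n)) : Prop :=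
  R < 2 * Finset.card {b : Fin R | (2 * ε') ^ 2 / (D.card : ℝ) ≤ l2SqEstimate (batch x b) D}

/-- The mixture parameters `0, ε'/2, ε', …, 1` that are tried. -/
def alphaGrid (ε' : ℝ) : Set ℝ :=
  insert 1 {α | α ≤ 1 ∧ ∃ i : ℕ, α = i * (ε' / 2)}

/-- The acceptance condition of the tester on the samples `x`, which consist of `R` batches of `m`
samples each. Some segmentation has to pass both the uniformity tests on the sets of the
refined division and the test of the overall shape. -/
def Accepts {n : ℕ} (k : ℕ) (ε : ℝ) (q : Fin n → ℝ) (R m : ℕ) (x : Fin (R * m) → Fin n) : Prop :=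
  let ε' := ε / 14
  let η := ε' / 4
  let t := k * numBuckets n η
  ∃ I : Segmentation n k,
    (∀ D ∈ refinedDivision I q η,
      ε' * ((R * m : ℕ) : ℝ) / (4 * (t : ℝ)) ≤ (countIn x D : ℝ) → ¬ LooksNonuniform ε' x D) ∧
    ∃ α ∈ alphaGrid ε', ∃ f : Fin n → ℝ, (∀ a, 0 ≤ f a) ∧ I.IsFlatOn f ∧
      coarseDist (refinedDivision I q η) (empirical x) (mixture α q f) < 2 * ε'

/-- The number of batches, `Θ(log (n / ε))`. -/
def numBatches (C : ℝ) (n : ℕ) (ε : ℝ) : ℕ := ⌈C * Real.log (4 * n / ε)⌉₊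

/-- The number of samples in a batch, `Θ(√(n t) / ε ^ 3)` with `t = k * v`. -/
def batchSize (C : ℝ) (n k : ℕ) (ε : ℝ) : ℕ :=
  ⌈C * √((n : ℝ) * ((k * numBuckets n (ε / 14 / 4) : ℕ) : ℝ)) / ε ^ 3⌉₊

end KFlat

end

/-!
Every set that occurs in a refined division is one of at most `n ^ 2 + 1` runs of elements of a
bucket of `q`, whatever the segmentation. Hence the bad events are controlled by a union bound over
these runs, not over the segmentations: for each run the collision estimate of a batch deviates
little from its mean by Chebyshev's inequality, and the majority vote of the batches makes the
failure probability exponentially small; and the empirical masses of all unions of runs are accurate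
by a Chernoff bound.

If `p = (1 - α) q + α r`, then on each set `D` of the division for the segmentation of `r` the
function `r` is constant and `q` is almost constant, so `p` is almost uniform on `D` and passes the
uniformity test, and `r` itself, with `α` rounded to the grid, witnesses the second condition.
Conversely, if a segmentation passes with `α` and `f`, then `p` and `(1 - α) q + α f` are both close
to their flattenings on the division and have almost the same masses on its sets, so they are close;
`f` almost has sum `1`, and normalizing it yields a flat distribution `r`.
-/

noncomputable section

open scoped Classical BigOperators
open MeasureTheory ProbabilityTheory

namespace KFlat

/-! ### Independent samples -/

section Samples

variable {α ι κ lam : Type*} [MeasurableSpace α] [Fintype ι] [Fintype κ] [Fintype lam]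

/-- The law of independent samples from `μ` that are indexed by `ι`. -/
abbrev iid (ι : Type*) [Fintype ι] (μ : Measure α) : Measure (ι → α) :=
  Measure.pi fun _ ↦ μ

variable (μ : Measure α) [IsProbabilityMeasure μ]

lemma measurePreserving_iid_uncurry (e : ι × κ ≃ lam) :
    MeasurePreserving (fun (y : ι → κ → α) l ↦ y (e.symm l).1 (e.symm l).2)
      (iid ι (iid κ μ)) (iid lam μ) where
  measurable := by fun_prop
  map_eq := by
    refine (Measure.pi_eq fun A hA ↦ ?_).symm
    have preimage_box : (fun (y : ι → κ → α) l ↦ y (e.symm l).1 (e.symm l).2) ⁻¹' Set.univ.pi A =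
        Set.univ.pi fun i ↦ Set.univ.pi fun j ↦ A (e (i, j)) := by
      ext y
      simp [← e.forall_congr_right (q := fun l ↦ y (e.symm l).1 (e.symm l).2 ∈ A l)]
    rw [Measure.map_apply (by fun_prop) (.univ_pi hA), preimage_box, Measure.pi_pi,
      ← e.prod_comp, Fintype.prod_prod_type]
    simp only [Measure.pi_pi]

lemma iid_real_curry (e : ι × κ ≃ lam) {E : Set (ι → κ → α)} (hE : MeasurableSet E) :
    (iid lam μ).real {x | (fun i j ↦ x (e (i, j))) ∈ E} = (iid ι (iid κ μ)).real E := by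
  have hE' : MeasurableSet {x : lam → α | (fun i j ↦ x (e (i, j))) ∈ E} :=
    hE.preimage (by fun_prop)
  rw [← (measurePreserving_iid_uncurry μ e).measureReal_preimage hE'.nullMeasurableSet]
  congr 1
  ext y
  simp

lemma integral_iid_succ [Finite α] [MeasurableSingletonClass α] {m : ℕ}
    (f : (Fin (m + 1) → α) → ℝ) :
    ∫ x, f x ∂iid (Fin (m + 1)) μ = ∫ a, ∫ y, f (Fin.cons a y) ∂iid (Fin m) μ ∂μ := by
  rw [← (measurePreserving_piFinSuccAbove (fun _ ↦ μ) 0).symm.integral_comp',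
    integral_prod _ .of_finite]
  simp [Fin.insertNthEquiv]

end Samples

/-! ### Concentration of the number of samples in a set -/

section Concentration

variable {α ι : Type*} [MeasurableSpace α] [Fintype ι] {μ : Measure α} [IsProbabilityMeasure μ]
  {A : Set α}

/-- The number of samples in `A`. -/
def hits (A : Set α) (x : ι → α) : ℕ :=
  Finset.card {i | x i ∈ A}

omit [MeasurableSpace α] in
lemma pow_hits (A : Set α) (w : ℝ) (x : ι → α) :
    w ^ hits A x = ∏ i, (1 + A.indicator (fun _ ↦ w - 1) (x i)) := by
  simp [hits, Set.indicator_apply, add_ite, Finset.prod_ite]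

lemma integrable_one_add_indicator_const (hA : MeasurableSet A) (c : ℝ) :
    Integrable (fun a ↦ 1 + A.indicator (fun _ ↦ c) a) μ :=
  (integrable_const 1).add ((integrable_const c).indicator hA)

lemma integral_pow_hits (hA : MeasurableSet A) (w : ℝ) :
    ∫ x : ι → α, w ^ hits A x ∂iid ι μ =
      (1 + (w - 1) * μ.real A) ^ Fintype.card ι := by
  simp_rw [pow_hits]
  rw [iid, integral_fintype_prod_eq_pow fun a ↦ 1 + A.indicator (fun _ ↦ w - 1) a,
    integral_add (integrable_const 1) ((integrable_const (w - 1)).indicator hA),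
    integral_indicator_const _ hA]
  simp [mul_comm]

lemma mul_measureReal_le_of_le_pow_hits (hA : MeasurableSet A) {w c : ℝ} (hw : 0 ≤ w)
    {E : Set (ι → α)} (hE : ∀ x ∈ E, c ≤ w ^ hits A x) (hc : 0 ≤ c) :
    c * (iid ι μ).real E ≤ (1 + (w - 1) * μ.real A) ^ Fintype.card ι := by
  have integrable_pow_hits :
      Integrable (fun x : ι → α ↦ w ^ hits A x) (iid ι μ) := by
    simp_rw [pow_hits]
    exact .fintype_prod fun _ ↦ integrable_one_add_indicator_const hA _
  calc c * (iid ι μ).real E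
      ≤ c * (iid ι μ).real {x | c ≤ w ^ hits A x} := by
        gcongr
        exacts [measure_ne_top _ _, hE]
    _ ≤ ∫ x : ι → α, w ^ hits A x ∂iid ι μ :=
        mul_meas_ge_le_integral_of_nonneg (ae_of_all _ fun _ ↦ by positivity) integrable_pow_hits c
    _ = _ := integral_pow_hits hA w

lemma measureReal_half_le_hits_le (hA : MeasurableSet A) (hμA : μ.real A ≤ 1 / 36) :
    (iid ι μ).real {x | Fintype.card ι ≤ 2 * hits A x} ≤
      (1 / 3) ^ Fintype.card ι := by
  have chernoff := mul_measureReal_le_of_le_pow_hits (μ := μ) (ι := ι) hA (w := 36)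
    (c := 6 ^ Fintype.card ι) (E := {x | Fintype.card ι ≤ 2 * hits A x})
    (by norm_num) (fun x (hx : _ ≤ _) ↦ by
      calc (6 : ℝ) ^ Fintype.card ι ≤ 6 ^ (2 * hits A x) :=
            pow_le_pow_right₀ (by norm_num) hx
        _ = 36 ^ hits A x := by rw [pow_mul]; norm_num) (by positivity)
  have pow_le : (1 + (36 - 1) * μ.real A) ^ Fintype.card ι ≤ (2 : ℝ) ^ Fintype.card ι := by
    have := measureReal_nonneg (μ := μ) (s := A)
    gcongr
    linarith
  rw [show (1 / 3 : ℝ) = 2 / 6 by norm_num, div_pow, le_div_iff₀' (by positivity)]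
  exact chernoff.trans pow_le

lemma one_add_pow_le_exp {x : ℝ} (hx : 0 ≤ 1 + x) (N : ℕ) : (1 + x) ^ N ≤ Real.exp (N * x) := by
  rw [Real.exp_nat_mul]
  gcongr
  linarith [Real.add_one_le_exp x]

lemma measureReal_le_hits_le_exp (hA : MeasurableSet A) {a : ℝ}
    (ha : Fintype.card ι * μ.real A ≤ a / 2) :
    (iid ι μ).real {x | a ≤ hits A x} ≤ Real.exp (-a / 6) := by
  have chernoff := mul_measureReal_le_of_le_pow_hits (μ := μ) hA (w := 2) (c := 2 ^ a)
    (E := {x : ι → α | a ≤ hits A x}) (by norm_num)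
    (fun x (hx : _ ≤ _) ↦ by
      rw [← Real.rpow_natCast]
      exact Real.rpow_le_rpow_of_exponent_le (by norm_num) hx) (by positivity)
  have hμA := measureReal_nonneg (μ := μ) (s := A)
  have ha0 : 0 ≤ a := by linarith [show 0 ≤ Fintype.card ι * μ.real A by positivity]
  rw [Real.rpow_def_of_pos two_pos] at chernoff
  refine le_of_mul_le_mul_left (chernoff.trans ?_) (Real.exp_pos (Real.log 2 * a))
  calc (1 + (2 - 1) * μ.real A) ^ Fintype.card ι
      ≤ Real.exp (Fintype.card ι * ((2 - 1) * μ.real A)) := one_add_pow_le_exp (by linarith) _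
    _ ≤ Real.exp (Real.log 2 * a + -a / 6) :=
        Real.exp_le_exp.2 (by nlinarith [Real.log_two_gt_d9])
    _ = _ := Real.exp_add _ _

lemma measureReal_hits_lt_le_exp (hA : MeasurableSet A) {a : ℝ} (ha0 : 0 ≤ a)
    (ha : a ≤ Fintype.card ι * μ.real A) :
    (iid ι μ).real {x | (hits A x : ℝ) < a / 4} ≤ Real.exp (-a / 6) := by
  have chernoff := mul_measureReal_le_of_le_pow_hits (μ := μ) hA (w := 1 / 2)
    (c := (1 / 2) ^ (a / 4)) (E := {x : ι → α | (hits A x : ℝ) < a / 4})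
    (by norm_num)
    (fun x (hx : _ < _) ↦ by
      rw [← Real.rpow_natCast]
      exact Real.rpow_le_rpow_of_exponent_ge (by norm_num) (by norm_num) hx.le) (by positivity)
  rw [Real.rpow_def_of_pos (by norm_num), one_div, Real.log_inv] at chernoff
  refine le_of_mul_le_mul_left (chernoff.trans ?_) (Real.exp_pos (-Real.log 2 * (a / 4)))
  have hμA : μ.real A ≤ 1 := measureReal_le_one
  calc (1 + (2⁻¹ - 1) * μ.real A) ^ Fintype.card ι
      ≤ Real.exp (Fintype.card ι * ((2⁻¹ - 1) * μ.real A)) := one_add_pow_le_exp (by linarith) _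
    _ ≤ Real.exp (-Real.log 2 * (a / 4) + -a / 6) :=
        Real.exp_le_exp.2 (by nlinarith [Real.log_two_lt_d9])
    _ = _ := Real.exp_add _ _

lemma measureReal_add_le_hits_le_exp (hA : MeasurableSet A) {a : ℝ} (ha : 0 ≤ a) :
    (iid ι μ).real {x | Fintype.card ι * (μ.real A + a) ≤ hits A x} ≤
      Real.exp (-2 * Fintype.card ι * a ^ 2) := by
  rcases isEmpty_or_nonempty ι with hι | hι
  · simp
  let X : ι → (ι → α) → ℝ := fun i x ↦ A.indicator 1 (x i) - μ.real A
  have independent_X : iIndepFun X (iid ι μ) :=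
    iIndepFun_pi (X := fun _ a ↦ A.indicator 1 a - μ.real A) fun _ ↦
      ((measurable_one.indicator hA).sub_const _).aemeasurable
  have subgaussian_X : ∀ i ∈ Finset.univ, HasSubgaussianMGF (X i) ((‖(1 : ℝ) - 0‖₊ / 2) ^ 2)
      (iid ι μ) := fun i _ ↦ by
    have h := hasSubgaussianMGF_of_mem_Icc (μ := iid ι μ) (a := 0) (b := 1)
      (X := fun x ↦ A.indicator 1 (x i))
      ((measurable_one.indicator hA).comp (measurable_pi_apply i)).aemeasurable
      (ae_of_all _ fun x ↦ ⟨Set.indicator_nonneg (by simp) _, Set.indicator_le_self' (by simp) _⟩)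
    rwa [integral_comp_eval (μ := fun _ ↦ μ) (f := A.indicator 1)
      (measurable_one.indicator hA).aestronglyMeasurable, integral_indicator_one hA] at h
  have hoeffding := HasSubgaussianMGF.measure_sum_ge_le_of_iIndepFun independent_X subgaussian_X
    (ε := Fintype.card ι * a) (by positivity)
  have sum_X (x : ι → α) :
      ∑ i, X i x = hits A x - Fintype.card ι * μ.real A := by
    simp [X, hits, Set.indicator_apply]
  simp_rw [sum_X, le_sub_iff_add_le'] at hoeffding
  have hι' : (Fintype.card ι : ℝ) ≠ 0 := by simp
  convert hoeffding using 2
  · simp [mul_add]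
  · simp
    field_simp

end Concentration

/-! ### Second moments of sums over pairs of samples -/

section PairSum

variable {α : Type*} {m : ℕ}

/-- The sum of the kernel `h` over all pairs of samples, an unnormalized U-statistic. -/
def pairSum (h : α → α → ℝ) (y : Fin m → α) : ℝ :=
  ∑ i, ∑ j ∈ Finset.Ioi i, h (y i) (y j)

lemma pairSum_cons (h : α → α → ℝ) (a : α) (y : Fin m → α) :
    pairSum h (Fin.cons a y : Fin (m + 1) → α) = ∑ j, h a (y j) + pairSum h y := by
  simp [pairSum, Fin.sum_univ_succ, Fin.sum_Ioi_succ]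

lemma pairSum_add (h h' : α → α → ℝ) (y : Fin m → α) :
    pairSum (fun a b ↦ h a b + h' a b) y = pairSum h y + pairSum h' y := by
  simp only [pairSum, Finset.sum_add_distrib]

lemma pairSum_const_mul (c : ℝ) (h : α → α → ℝ) (y : Fin m → α) :
    pairSum (fun a b ↦ c * h a b) y = c * pairSum h y := by
  simp only [pairSum, Finset.mul_sum]

lemma pairSum_mono {h h' : α → α → ℝ} (hh : ∀ a b, h a b ≤ h' a b) (y : Fin m → α) :
    pairSum h y ≤ pairSum h' y :=
  Finset.sum_le_sum fun _ _ ↦ Finset.sum_le_sum fun _ _ ↦ hh _ _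

lemma pairSum_add_separate (g : α → ℝ) (y : Fin m → α) :
    pairSum (fun a b ↦ g a + g b) y = (m - 1) * ∑ i, g (y i) := by
  induction m with
  | zero => simp [pairSum]
  | succ m ih =>
    rw [← Fin.cons_self_tail y, pairSum_cons, ih, Fin.sum_univ_succ, Finset.sum_add_distrib]
    simp only [Finset.sum_const, Finset.card_univ, Fintype.card_fin, nsmul_eq_mul, Fin.cons_zero,
      Fin.cons_succ]
    push_cast
    ring

lemma pairSum_const (c : ℝ) (y : Fin m → α) :
    pairSum (fun _ _ ↦ c) y = m * (m - 1) / 2 * c := by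
  have h := pairSum_add_separate (fun _ ↦ c / 2) y
  simp only [add_halves, Finset.sum_const, Finset.card_univ, Fintype.card_fin, nsmul_eq_mul] at h
  rw [h]
  ring

variable [Finite α] [MeasurableSpace α] [MeasurableSingletonClass α]
  {μ : Measure α} [IsProbabilityMeasure μ]

lemma integral_sq_sum_of_integral_eq_zero {f : α → ℝ} (hf : ∫ a, f a ∂μ = 0) (m : ℕ) :
    ∫ y, (∑ i, f (y i)) ^ 2 ∂iid (Fin m) μ = m * ∫ a, f a ^ 2 ∂μ := by
  have integral_sum : ∫ y, ∑ i, f (y i) ∂iid (Fin m) μ = 0 := by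
    rw [integral_finsetSum _ fun _ _ ↦ .of_finite]
    exact Finset.sum_eq_zero fun i _ ↦
      (integral_comp_eval (μ := fun _ ↦ μ) (by fun_prop)).trans hf
  have variance_sum := variance_sum_pi (μ := fun _ : Fin m ↦ μ) (X := fun _ ↦ f)
    fun _ ↦ .of_discrete
  rw [variance_of_integral_eq_zero (by fun_prop) (by simpa using integral_sum)] at variance_sum
  simpa [variance_of_integral_eq_zero (by fun_prop) hf] using variance_sum

lemma integral_sq_sub_integral_le (f : α → ℝ) :
    ∫ a, (f a - ∫ b, f b ∂μ) ^ 2 ∂μ ≤ ∫ a, f a ^ 2 ∂μ := by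
  rw [← variance_eq_integral (by fun_prop)]
  exact variance_le_expectation_sq (by fun_prop)

lemma integral_sq_pairSum_of_degenerate {w : α → α → ℝ} (hleft : ∀ b, ∫ a, w a b ∂μ = 0)
    (hright : ∀ a, ∫ b, w a b ∂μ = 0) (m : ℕ) :
    ∫ y, pairSum w y ^ 2 ∂iid (Fin m) μ = m * (m - 1) / 2 * ∫ a, ∫ b, w a b ^ 2 ∂μ ∂μ := by
  induction m with
  | zero => simp [pairSum]
  | succ m ih =>
    have cross_term :
        ∫ a, ∫ y, (∑ j, w a (y j)) * pairSum w y ∂iid (Fin m) μ ∂μ = 0 := by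
      rw [integral_integral_swap .of_finite]
      simp_rw [integral_mul_const, integral_finsetSum _ fun _ _ ↦ Integrable.of_finite, hleft]
      simp
    calc ∫ y, pairSum w y ^ 2 ∂iid (Fin (m + 1)) μ
        = ∫ a, ((m * ∫ b, w a b ^ 2 ∂μ) +
            2 * (∫ y, (∑ j, w a (y j)) * pairSum w y ∂iid (Fin m) μ) +
            m * (m - 1) / 2 * ∫ a, ∫ b, w a b ^ 2 ∂μ ∂μ) ∂μ := by
          rw [integral_iid_succ]
          congr! with a
          simp_rw [pairSum_cons, add_sq, mul_assoc]
          rw [integral_add .of_finite .of_finite, integral_add .of_finite .of_finite,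
            integral_sq_sum_of_integral_eq_zero (hright a), integral_const_mul, ih]
      _ = m * ∫ a, ∫ b, w a b ^ 2 ∂μ ∂μ +
            m * (m - 1) / 2 * ∫ a, ∫ b, w a b ^ 2 ∂μ ∂μ := by
          rw [integral_add .of_finite .of_finite, integral_add .of_finite .of_finite,
            integral_const_mul, integral_const_mul, cross_term]
          simp
      _ = _ := by
          push_cast
          ring

/-- The completely degenerate part of a kernel in Hoeffding's decomposition. -/
def degeneratePart (μ : Measure α) (h : α → α → ℝ) (a b : α) : ℝ :=
  (h a b - ∫ c, h a c ∂μ) - (∫ c, h b c ∂μ - ∫ c, ∫ d, h c d ∂μ ∂μ)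

lemma integral_sub_integral_right {h : α → α → ℝ} (hsymm : ∀ a b, h a b = h b a) (b : α) :
    ∫ a, (h a b - ∫ c, h a c ∂μ) ∂μ = ∫ c, h b c ∂μ - ∫ c, ∫ d, h c d ∂μ ∂μ := by
  rw [integral_sub .of_finite .of_finite]
  simp_rw [hsymm _ b]

lemma integral_degeneratePart_left {h : α → α → ℝ} (hsymm : ∀ a b, h a b = h b a) (b : α) :
    ∫ a, degeneratePart μ h a b ∂μ = 0 := by
  simp_rw [degeneratePart]
  rw [integral_sub .of_finite .of_finite, integral_sub_integral_right hsymm]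
  simp

lemma integral_degeneratePart_right (h : α → α → ℝ) (a : α) :
    ∫ b, degeneratePart μ h a b ∂μ = 0 := by
  simp_rw [degeneratePart]
  rw [integral_sub .of_finite .of_finite, integral_sub .of_finite .of_finite,
    integral_sub .of_finite .of_finite]
  simp

lemma integral_sq_degeneratePart_le {h : α → α → ℝ} (hsymm : ∀ a b, h a b = h b a) :
    ∫ a, ∫ b, degeneratePart μ h a b ^ 2 ∂μ ∂μ ≤ ∫ a, ∫ b, h a b ^ 2 ∂μ ∂μ :=
  calc ∫ a, ∫ b, degeneratePart μ h a b ^ 2 ∂μ ∂μ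
      = ∫ b, ∫ a, degeneratePart μ h a b ^ 2 ∂μ ∂μ := integral_integral_swap .of_finite
    _ ≤ ∫ b, ∫ a, (h a b - ∫ c, h a c ∂μ) ^ 2 ∂μ ∂μ :=
        integral_mono .of_finite .of_finite fun b ↦ by
          simp only [degeneratePart, ← integral_sub_integral_right hsymm b]
          exact integral_sq_sub_integral_le fun a ↦ h a b - ∫ c, h a c ∂μ
    _ = ∫ a, ∫ b, (h a b - ∫ c, h a c ∂μ) ^ 2 ∂μ ∂μ := integral_integral_swap .of_finite
    _ ≤ ∫ a, ∫ b, h a b ^ 2 ∂μ ∂μ :=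
        integral_mono .of_finite .of_finite fun a ↦ integral_sq_sub_integral_le (h a)

omit [Finite α] [MeasurableSingletonClass α] [IsProbabilityMeasure μ] in
lemma pairSum_sub_mean_eq (h : α → α → ℝ) (y : Fin m → α) :
    pairSum h y - m * (m - 1) / 2 * ∫ a, ∫ b, h a b ∂μ ∂μ =
      (m - 1) * ∑ i, (∫ b, h (y i) b ∂μ - ∫ a, ∫ b, h a b ∂μ ∂μ) +
        pairSum (degeneratePart μ h) y := by
  rw [← pairSum_add_separate fun a ↦ ∫ b, h a b ∂μ - ∫ c, ∫ b, h c b ∂μ ∂μ, ← pairSum_const,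
    ← pairSum_add, sub_eq_iff_eq_add, ← pairSum_add]
  congr 1
  ext a b
  rw [degeneratePart]
  ring

lemma integral_sq_pairSum_sub_mean_le {h : α → α → ℝ} (hsymm : ∀ a b, h a b = h b a)
    (hm : 1 ≤ m) :
    ∫ y, (pairSum h y - m * (m - 1) / 2 * ∫ a, ∫ b, h a b ∂μ ∂μ) ^ 2 ∂iid (Fin m) μ ≤
      2 * (m - 1) ^ 2 * m * ∫ a, (∫ b, h a b ∂μ) ^ 2 ∂μ +
        m * (m - 1) * ∫ a, ∫ b, h a b ^ 2 ∂μ ∂μ := by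
  have hm' : (0 : ℝ) ≤ m - 1 := sub_nonneg.2 (by exact_mod_cast hm)
  let g (a : α) : ℝ := ∫ b, h a b ∂μ - ∫ a, ∫ b, h a b ∂μ ∂μ
  have integral_g : ∫ a, g a ∂μ = 0 := by
    rw [integral_sub .of_finite .of_finite]
    simp
  calc ∫ y, (pairSum h y - m * (m - 1) / 2 * ∫ a, ∫ b, h a b ∂μ ∂μ) ^ 2 ∂iid (Fin m) μ
      ≤ ∫ y, (2 * (m - 1) ^ 2 * (∑ i, g (y i)) ^ 2 +
          2 * pairSum (degeneratePart μ h) y ^ 2) ∂iid (Fin m) μ :=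
        integral_mono .of_finite .of_finite fun y ↦ by
          simp only [pairSum_sub_mean_eq]
          linarith [add_sq_le (a := (m - 1) * ∑ i, g (y i)) (b := pairSum (degeneratePart μ h) y)]
    _ = 2 * (m - 1) ^ 2 * (m * ∫ a, g a ^ 2 ∂μ) +
          2 * (m * (m - 1) / 2 * ∫ a, ∫ b, degeneratePart μ h a b ^ 2 ∂μ ∂μ) := by
        rw [integral_add .of_finite .of_finite, integral_const_mul, integral_const_mul,
          integral_sq_sum_of_integral_eq_zero integral_g,
          integral_sq_pairSum_of_degenerate (integral_degeneratePart_left hsymm)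
            (integral_degeneratePart_right h)]
    _ ≤ 2 * (m - 1) ^ 2 * (m * ∫ a, (∫ b, h a b ∂μ) ^ 2 ∂μ) +
          2 * (m * (m - 1) / 2 * ∫ a, ∫ b, h a b ^ 2 ∂μ ∂μ) := by
        gcongr 2 * (m - 1) ^ 2 * (m * ?_) + 2 * (m * (m - 1) / 2 * ?_)
        · exact integral_sq_sub_integral_le fun a ↦ ∫ b, h a b ∂μ
        · exact integral_sq_degeneratePart_le hsymm
    _ = _ := by ring

lemma sq_mul_measureReal_mul_nonpos_le {Ω : Type*} [MeasurableSpace Ω] {P : Measure Ω}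
    [IsFiniteMeasure P] {X : Ω → ℝ} {c : ℝ} (hX : Integrable (fun y ↦ (X y - c) ^ 2) P) :
    c ^ 2 * P.real {y | c * X y ≤ 0} ≤ ∫ y, (X y - c) ^ 2 ∂P := by
  calc c ^ 2 * P.real {y | c * X y ≤ 0} ≤ c ^ 2 * P.real {y | c ^ 2 ≤ (X y - c) ^ 2} := by
        refine mul_le_mul_of_nonneg_left (measureReal_mono fun y (hy : c * X y ≤ 0) ↦ ?_)
          (sq_nonneg c)
        change c ^ 2 ≤ (X y - c) ^ 2
        linarith [sq_nonneg (X y)]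
    _ ≤ ∫ y, (X y - c) ^ 2 ∂P :=
        mul_meas_ge_le_integral_of_nonneg (ae_of_all _ fun _ ↦ sq_nonneg _) hX _

lemma measureReal_mul_pairSum_nonpos_le {h : α → α → ℝ} (hsymm : ∀ a b, h a b = h b a)
    (hm : 2 ≤ m) {θ G H : ℝ} (hθ0 : θ ≠ 0) (hθ : ∫ a, ∫ b, h a b ∂μ ∂μ = θ)
    (hG : ∫ a, (∫ b, h a b ∂μ) ^ 2 ∂μ ≤ G) (hH : ∫ a, ∫ b, h a b ^ 2 ∂μ ∂μ ≤ H) :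
    (iid (Fin m) μ).real {y | θ * pairSum h y ≤ 0} ≤
      8 * (G / (m * θ ^ 2) + H / (m * θ) ^ 2) := by
  have hm' : (2 : ℝ) ≤ m := by exact_mod_cast hm
  have : (0 : ℝ) < m := by linarith
  have hm1 : (0 : ℝ) < m - 1 := by linarith
  have hH0 : 0 ≤ H := hH.trans' <| integral_nonneg fun _ ↦ integral_nonneg fun _ ↦ sq_nonneg _
  let M : ℝ := m * (m - 1) / 2
  have hM : 0 < M := by positivity
  have second_moment := integral_sq_pairSum_sub_mean_le (μ := μ) hsymm (m := m) (by lia)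
  rw [hθ] at second_moment
  have chebyshev : (M * θ) ^ 2 * (iid (Fin m) μ).real {y | θ * pairSum h y ≤ 0} ≤
      2 * (m - 1) ^ 2 * m * G + m * (m - 1) * H :=
    calc (M * θ) ^ 2 * (iid (Fin m) μ).real {y | θ * pairSum h y ≤ 0}
        ≤ (M * θ) ^ 2 * (iid (Fin m) μ).real {y | M * θ * pairSum h y ≤ 0} := by
          refine mul_le_mul_of_nonneg_left (measureReal_mono fun y hy ↦ ?_) (sq_nonneg _)
          exact (mul_assoc _ _ _).trans_le (mul_nonpos_of_nonneg_of_nonpos hM.le hy)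
      _ ≤ ∫ y, (pairSum h y - M * θ) ^ 2 ∂iid (Fin m) μ :=
          sq_mul_measureReal_mul_nonpos_le .of_finite
      _ ≤ 2 * (m - 1) ^ 2 * m * G + m * (m - 1) * H := second_moment.trans (by gcongr)
  calc (iid (Fin m) μ).real {y | θ * pairSum h y ≤ 0}
      ≤ (2 * (m - 1) ^ 2 * m * G + m * (m - 1) * H) / (M * θ) ^ 2  :=
        (le_div_iff₀' (by positivity)).2 chebyshev
    _ = 8 * (G / (m * θ ^ 2)) + 4 * m / (m - 1) * (H / (m * θ) ^ 2) := by
        simp only [M]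
        field_simp
        ring
    _ ≤ 8 * (G / (m * θ ^ 2)) + 8 * (H / (m * θ) ^ 2) := by
        gcongr
        rw [div_le_iff₀ hm1]
        linarith
    _ = _ := by ring

end PairSum

/-! ### Distributions on `[n]` as measures -/

section DistMeasure

variable {n s : ℕ} {p : Fin n → ℝ}

/-- The measure on `[n]` with mass function `p` (negative values of `p` count as `0`). It gives
access to Mathlib's probability theory for the sums in `sampleProb`. -/
def distMeasure (p : Fin n → ℝ) : Measure (Fin n) :=
  ∑ a, ENNReal.ofReal (p a) • Measure.dirac a

lemma distMeasure_singleton (p : Fin n → ℝ) (a : Fin n) :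
    distMeasure p {a} = ENNReal.ofReal (p a) := by
  simp [distMeasure, Measure.finsetSum_apply, Set.indicator_apply]

lemma isProbabilityMeasure_distMeasure (hp : p ∈ stdSimplex ℝ (Fin n)) :
    IsProbabilityMeasure (distMeasure p) where
  measure_univ := by
    rw [← Finset.coe_univ, ← sum_measure_singleton]
    simp_rw [distMeasure_singleton]
    rw [← ENNReal.ofReal_sum_of_nonneg fun a _ ↦ hp.1 a, hp.2, ENNReal.ofReal_one]

instance : IsFiniteMeasure (distMeasure p) where
  measure_univ_lt_top := by simp [distMeasure]

lemma distMeasure_real_singleton (hp : 0 ≤ p) (a : Fin n) : (distMeasure p).real {a} = p a := by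
  rw [measureReal_def, distMeasure_singleton, ENNReal.toReal_ofReal (hp a)]

lemma sampleProb_eq_iid_real (hp : 0 ≤ p) (E : (Fin s → Fin n) → Prop) :
    sampleProb p s E = (iid (Fin s) (distMeasure p)).real {x | E x} := by
  have coe_event : {x | E x} = ((Finset.univ.filter E : Finset _) : Set (Fin s → Fin n)) := by simp
  rw [coe_event, ← sum_measureReal_singleton, sampleProb, Finset.sum_filter]
  congr! with x
  simp_rw [iid, measureReal_def, Measure.pi_singleton, ENNReal.toReal_prod, ← measureReal_def,
    distMeasure_real_singleton hp]

lemma countIn_eq_hits (x : Fin s → Fin n) (D : Finset (Fin n)) : countIn x D = hits D x := by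
  simp [countIn, hits]

end DistMeasure

/-! ### The collision test -/

section Collisions

variable {n m : ℕ} (D : Finset (Fin n)) {τ : ℝ}

lemma countIn_cons (a : Fin n) (y : Fin m → Fin n) :
    countIn (Fin.cons a y : Fin (m + 1) → Fin n) D = (if a ∈ D then 1 else 0) + countIn y D := by
  simp only [countIn, Finset.card_filter, Fin.sum_univ_succ, Fin.cons_zero, Fin.cons_succ]

lemma choose_countIn_eq_pairSum (y : Fin m → Fin n) :
    ((countIn y D).choose 2 : ℝ) = pairSum (fun a b ↦ if a ∈ D ∧ b ∈ D then 1 else 0) y := by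
  induction m with
  | zero => simp [pairSum, countIn]
  | succ m ih =>
    rw [← Fin.cons_self_tail y, pairSum_cons, ← ih, countIn_cons]
    by_cases hy : y 0 ∈ D
    · simp only [hy, if_true, true_and, add_comm 1, Nat.choose_succ_succ', Nat.choose_one_right]
      simp [countIn]
    · simp [hy]

lemma collisions_eq_pairSum (y : Fin m → Fin n) :
    (collisions y D : ℝ) = pairSum (fun a b ↦ if a = b ∧ a ∈ D then 1 else 0) y := by
  rw [collisions, Finset.card_filter, Fintype.sum_prod_type, pairSum]
  push_cast
  refine Finset.sum_congr rfl fun i _ ↦ ?_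
  rw [← Finset.sum_subset (Finset.subset_univ (Finset.Ioi i))]
  · exact Finset.sum_congr rfl fun j hj ↦ by simp only [Finset.mem_Ioi.1 hj, true_and]
  · intro j _ hj
    rw [if_neg fun h ↦ hj (Finset.mem_Ioi.2 h.1)]

lemma collisions_le_choose (y : Fin m → Fin n) :
    (collisions y D : ℝ) ≤ (countIn y D).choose 2 := by
  rw [collisions_eq_pairSum, choose_countIn_eq_pairSum]
  refine pairSum_mono (fun a b ↦ ?_) y
  by_cases hab : a = b
  · simp [hab]
  · simp only [hab, false_and, if_false]
    positivity

/-- The kernel whose sum over all pairs of samples is the number of collisions in `D` minus `θ`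
times the number of pairs in `D`. -/
def collisionKernel (θ : ℝ) (a b : Fin n) : ℝ :=
  (if a = b ∧ a ∈ D then 1 else 0) + -θ * (if a ∈ D ∧ b ∈ D then 1 else 0)

lemma pairSum_collisionKernel (y : Fin m → Fin n) (θ : ℝ) :
    pairSum (collisionKernel D θ) y = collisions y D - θ * (countIn y D).choose 2 := by
  rw [collisions_eq_pairSum, choose_countIn_eq_pairSum, sub_eq_add_neg, ← neg_mul,
    ← pairSum_const_mul, ← pairSum_add]
  rfl

lemma collisionKernel_comm (θ : ℝ) (a b : Fin n) :
    collisionKernel D θ a b = collisionKernel D θ b a := by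
  by_cases hab : a = b
  · rw [hab]
  · simp [collisionKernel, hab, Ne.symm hab, and_comm]

variable {D}

lemma pairSum_collisionKernel_nonneg {y : Fin m → Fin n}
    (hy : τ / (D.card : ℝ) ≤ l2SqEstimate y D) :
    0 ≤ pairSum (collisionKernel D ((1 + τ) / D.card)) y := by
  rw [pairSum_collisionKernel, sub_nonneg]
  rw [l2SqEstimate, le_sub_iff_add_le', ← add_div] at hy
  rcases (Nat.cast_nonneg (α := ℝ) ((countIn y D).choose 2)).eq_or_lt with no_pairs | pairs
  · simp [← no_pairs]
  · exact (le_div_iff₀ pairs).1 hy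

lemma pairSum_collisionKernel_nonpos {y : Fin m → Fin n}
    (hy : l2SqEstimate y D < τ / (D.card : ℝ)) :
    pairSum (collisionKernel D ((1 + τ) / D.card)) y ≤ 0 := by
  rw [pairSum_collisionKernel, sub_nonpos]
  rw [l2SqEstimate, sub_lt_iff_lt_add', ← add_div] at hy
  rcases (Nat.cast_nonneg (α := ℝ) ((countIn y D).choose 2)).eq_or_lt with no_pairs | pairs
  · simpa [← no_pairs] using collisions_le_choose D y
  · exact ((div_lt_iff₀ pairs).1 hy).le

end Collisions

lemma sum_sq_sub_expect {ι : Type*} (s : Finset ι) (f : ι → ℝ) :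
    ∑ i ∈ s, (f i - 𝔼 j ∈ s, f j) ^ 2 = ∑ i ∈ s, f i ^ 2 - (∑ i ∈ s, f i) * 𝔼 i ∈ s, f i := by
  simp_rw [sub_sq]
  rw [Finset.sum_add_distrib, Finset.sum_sub_distrib, ← Finset.sum_mul, ← Finset.mul_sum,
    Finset.sum_const, nsmul_eq_mul, sq (𝔼 i ∈ s, f i), ← mul_assoc, Finset.card_mul_expect]
  ring

section Moments

variable {n : ℕ} (μ : Measure (Fin n)) [IsProbabilityMeasure μ] (D : Finset (Fin n)) (θ : ℝ)

lemma integral_indicator_eq_sum (f : Fin n → ℝ) :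
    ∫ a, (if a ∈ D then f a else 0) ∂μ = ∑ a ∈ D, μ.real {a} * f a := by
  simp [integral_fintype Integrable.of_finite]

lemma integral_collisionKernel (a : Fin n) :
    ∫ b, collisionKernel D θ a b ∂μ = if a ∈ D then μ.real {a} - θ * μ.real D else 0 := by
  by_cases ha : a ∈ D
  · simp only [collisionKernel, ha, and_true, true_and, if_true]
    rw [integral_add .of_finite .of_finite, integral_const_mul, integral_indicator_eq_sum]
    simp [integral_fintype Integrable.of_finite, sub_eq_add_neg]
  · simp [collisionKernel, ha]

lemma integral_integral_collisionKernel :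
    ∫ a, ∫ b, collisionKernel D θ a b ∂μ ∂μ =
      ∑ a ∈ D, μ.real {a} ^ 2 - θ * μ.real D ^ 2 := by
  simp_rw [integral_collisionKernel, integral_indicator_eq_sum, mul_sub, Finset.sum_sub_distrib,
    ← Finset.sum_mul, sum_measureReal_singleton, ← sq]
  ring

lemma integral_sq_integral_collisionKernel :
    ∫ a, (∫ b, collisionKernel D θ a b ∂μ) ^ 2 ∂μ =
      ∑ a ∈ D, μ.real {a} * (μ.real {a} - θ * μ.real D) ^ 2 := by
  simp_rw [integral_collisionKernel, ite_pow, zero_pow two_ne_zero, integral_indicator_eq_sum]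

variable {θ}

lemma integral_sq_collisionKernel_le (hθ : 0 ≤ θ) :
    ∫ a, ∫ b, collisionKernel D θ a b ^ 2 ∂μ ∂μ ≤
      ∑ a ∈ D, μ.real {a} ^ 2 + (θ * μ.real D) ^ 2 := by
  have sq_kernel_le (a b) : collisionKernel D θ a b ^ 2 ≤ collisionKernel D (-θ ^ 2) a b := by
    rw [collisionKernel, collisionKernel]
    split_ifs <;> simp_all
    nlinarith
  calc ∫ a, ∫ b, collisionKernel D θ a b ^ 2 ∂μ ∂μ
      ≤ ∫ a, ∫ b, collisionKernel D (-θ ^ 2) a b ∂μ ∂μ :=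
        integral_mono .of_finite .of_finite fun a ↦
          integral_mono .of_finite .of_finite (sq_kernel_le a)
    _ = _ := by
        rw [integral_integral_collisionKernel]
        ring

end Moments

section CollisionTest

variable {n m : ℕ} {μ : Measure (Fin n)} {D : Finset (Fin n)} {τ e : ℝ}

/-- The average mass of the points of `D`. -/
def avgMass (μ : Measure (Fin n)) (D : Finset (Fin n)) : ℝ :=
  𝔼 a ∈ D, μ.real {a}

/-- The squared `ℓ₂`-distance on `D` between `μ` and the multiple of the uniform distribution
that has the same mass. -/
def sqDistUniform (μ : Measure (Fin n)) (D : Finset (Fin n)) : ℝ :=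
  ∑ a ∈ D, (μ.real {a} - avgMass μ D) ^ 2

lemma avgMass_nonneg : 0 ≤ avgMass μ D :=
  Finset.expect_nonneg fun _ _ ↦ measureReal_nonneg

lemma card_mul_avgMass [IsFiniteMeasure μ] : D.card * avgMass μ D = μ.real D := by
  rw [avgMass, Finset.card_mul_expect, sum_measureReal_singleton]

lemma div_card_mul_measureReal [IsFiniteMeasure μ] (c : ℝ) :
    c / D.card * μ.real D = c * avgMass μ D := by
  rw [avgMass, Finset.expect_eq_sum_div_card, sum_measureReal_singleton]
  ring

variable [IsProbabilityMeasure μ]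

lemma sum_sq_measureReal_singleton :
    ∑ a ∈ D, μ.real {a} ^ 2 = sqDistUniform μ D + avgMass μ D * μ.real D := by
  rw [sqDistUniform, avgMass, sum_sq_sub_expect, sum_measureReal_singleton]
  ring

lemma integral_integral_collisionKernel_threshold :
    ∫ a, ∫ b, collisionKernel D ((1 + τ) / D.card) a b ∂μ ∂μ =
      sqDistUniform μ D - τ * (avgMass μ D * μ.real D) := by
  rw [integral_integral_collisionKernel, sum_sq_measureReal_singleton, sq, ← mul_assoc,
    div_card_mul_measureReal]
  ring

lemma integral_sq_collisionKernel_threshold_le (hD : 2 ≤ D.card) (hτ : 0 ≤ τ) (hτ' : τ ≤ 1 / 3) :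
    ∫ a, ∫ b, collisionKernel D ((1 + τ) / D.card) a b ^ 2 ∂μ ∂μ ≤
      sqDistUniform μ D + 2 * (avgMass μ D * μ.real D) := by
  have two_mul_avgMass_le : 2 * avgMass μ D ≤ μ.real D := by
    rw [← card_mul_avgMass]
    gcongr
    exacts [avgMass_nonneg, by exact_mod_cast hD]
  have sq_le_two : (1 + τ) ^ 2 ≤ 2 := by nlinarith
  have hA : 0 ≤ avgMass μ D := avgMass_nonneg
  calc ∫ a, ∫ b, collisionKernel D ((1 + τ) / D.card) a b ^ 2 ∂μ ∂μ
      ≤ sqDistUniform μ D + avgMass μ D * μ.real D + ((1 + τ) * avgMass μ D) ^ 2 := by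
        rw [← sum_sq_measureReal_singleton, ← div_card_mul_measureReal]
        exact integral_sq_collisionKernel_le μ D (by positivity)
    _ ≤ sqDistUniform μ D + avgMass μ D * μ.real D + avgMass μ D * (2 * avgMass μ D) := by
        rw [mul_pow, mul_left_comm, ← sq]
        gcongr
    _ ≤ sqDistUniform μ D + avgMass μ D * μ.real D + avgMass μ D * μ.real D := by gcongr
    _ = _ := by ring

lemma measureReal_mul_pairSum_collisionKernel_nonpos_le {M : ℝ} (hD : 2 ≤ D.card) (hτ : 0 ≤ τ)
    (hτ' : τ ≤ 1 / 3) (hM0 : M ≠ 0)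
    (hM : M = sqDistUniform μ D - τ * (avgMass μ D * μ.real D)) (hm : 2 ≤ m)
    (hG : ∑ a ∈ D, μ.real {a} * (μ.real {a} - (1 + τ) * avgMass μ D) ^ 2 ≤ m * M ^ 2 / 1000)
    (hH : sqDistUniform μ D + 2 * (avgMass μ D * μ.real D) ≤ (m * M) ^ 2 / 1000) :
    (iid (Fin m) μ).real
      {y | M * pairSum (collisionKernel D ((1 + τ) / D.card)) y ≤ 0} ≤ 1 / 36 := by
  have : (0 : ℝ) < m := by exact_mod_cast (by lia : 0 < m)
  refine (measureReal_mul_pairSum_nonpos_le (G := m * M ^ 2 / 1000) (collisionKernel_comm D _) hm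
    hM0 (integral_integral_collisionKernel_threshold.trans hM.symm) ?_
    ((integral_sq_collisionKernel_threshold_le hD hτ hτ').trans hH)).trans ?_
  · rwa [integral_sq_integral_collisionKernel, div_card_mul_measureReal]
  · field_simp
    norm_num

/-- The number `m` of samples in a batch is large enough for the collision test with tolerance
`e` on `D`. -/
def EnoughSamples (μ : Measure (Fin n)) (D : Finset (Fin n)) (e : ℝ) (m : ℕ) : Prop :=
  10000 * √(D.card : ℝ) ≤ m * μ.real D * e ^ 2

namespace EnoughSamples

omit [IsProbabilityMeasure μ] in
lemma le_mul (h : EnoughSamples μ D e m) (hD : D.Nonempty) : 10000 ≤ m * μ.real D * e ^ 2 := by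
  have : (1 : ℝ) ≤ √D.card := Real.one_le_sqrt.2 (by exact_mod_cast hD.card_pos)
  rw [EnoughSamples] at h
  linarith

omit [IsProbabilityMeasure μ] in
lemma measureReal_pos (h : EnoughSamples μ D e m) (hD : D.Nonempty) : 0 < μ.real D := by
  by_contra! hμ
  have := h.le_mul hD
  rw [hμ.antisymm measureReal_nonneg] at this
  linarith

lemma avgMass_pos (h : EnoughSamples μ D e m) (hD : D.Nonempty) : 0 < avgMass μ D := by
  have hμ := h.measureReal_pos hD
  rw [← card_mul_avgMass] at hμ
  exact pos_of_mul_pos_right hμ (by positivity)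

lemma sq_mul_le (h : EnoughSamples μ D e m) (hD : D.Nonempty) :
    100000000 ≤ m ^ 2 * e ^ 4 * (avgMass μ D * μ.real D) := by
  have hd : (0 : ℝ) < D.card := by exact_mod_cast hD.card_pos
  refine le_of_mul_le_mul_right ?_ hd
  calc (100000000 : ℝ) * D.card = (10000 * √D.card) ^ 2 := by
        rw [mul_pow, Real.sq_sqrt hd.le]
        norm_num
    _ ≤ (m * μ.real D * e ^ 2) ^ 2 := pow_le_pow_left₀ (by positivity) h 2
    _ = m ^ 2 * e ^ 4 * (avgMass μ D * μ.real D) * D.card := by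
        rw [← card_mul_avgMass]
        ring

lemma two_le (h : EnoughSamples μ D e m) (he : 0 < e) (he' : e ≤ 1 / 7) (hD : D.Nonempty) :
    2 ≤ m := by
  have hμ : μ.real D ≤ 1 := measureReal_le_one
  have le_cast : (10000 : ℝ) ≤ m :=
    calc (10000 : ℝ) ≤ m * μ.real D * e ^ 2 := h.le_mul hD
      _ ≤ m * 1 * 1 := by
          gcongr
          nlinarith
      _ = m := by ring
  exact_mod_cast (by norm_num : (2 : ℝ) ≤ 10000).trans le_cast

omit [IsProbabilityMeasure μ] in
lemma avgMass_le_mul_sqDistUniform (h : EnoughSamples μ D e m) (hD : D.Nonempty)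
    (far : 9 * e ^ 2 * (avgMass μ D * μ.real D) ≤ sqDistUniform μ D) :
    90000 * avgMass μ D ≤ m * sqDistUniform μ D :=
  calc 90000 * avgMass μ D ≤ m * μ.real D * e ^ 2 * (9 * avgMass μ D) := by
        nlinarith [h.le_mul hD, avgMass_nonneg (μ := μ) (D := D)]
    _ = m * (9 * e ^ 2 * (avgMass μ D * μ.real D)) := by ring
    _ ≤ m * sqDistUniform μ D := by gcongr

lemma le_sq_mul_sqDistUniform (h : EnoughSamples μ D e m) (hD : D.Nonempty)
    (far : 9 * e ^ 2 * (avgMass μ D * μ.real D) ≤ sqDistUniform μ D) :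
    900000000 ≤ m ^ 2 * e ^ 2 * sqDistUniform μ D :=
  calc (900000000 : ℝ) ≤ m ^ 2 * e ^ 2 * (9 * e ^ 2 * (avgMass μ D * μ.real D)) := by
        linarith [h.sq_mul_le hD]
    _ ≤ m ^ 2 * e ^ 2 * sqDistUniform μ D := by gcongr

end EnoughSamples

omit [IsProbabilityMeasure μ] in
lemma sqDistUniform_le_of_near
    (near : ∀ a ∈ D, |μ.real {a} - avgMass μ D| ≤ e * avgMass μ D) :
    sqDistUniform μ D ≤ D.card * (e * avgMass μ D) ^ 2 := by
  rw [← nsmul_eq_mul]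
  exact Finset.sum_le_card_nsmul _ _ _ fun a ha ↦ sq_le_sq.2 ((near a ha).trans (le_abs_self _))

lemma sum_mul_sq_sub_threshold_le_of_near (he : 0 ≤ e) (he' : e ≤ 1 / 7)
    (near : ∀ a ∈ D, |μ.real {a} - avgMass μ D| ≤ e * avgMass μ D) :
    ∑ a ∈ D, μ.real {a} * (μ.real {a} - (1 + (2 * e) ^ 2) * avgMass μ D) ^ 2 ≤
      μ.real D * (2 * e * avgMass μ D) ^ 2 := by
  rw [← sum_measureReal_singleton, Finset.sum_mul]
  refine Finset.sum_le_sum fun a ha ↦ mul_le_mul_of_nonneg_left ?_ measureReal_nonneg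
  have heA : 0 ≤ e * avgMass μ D := mul_nonneg he avgMass_nonneg
  have ⟨sub_ge, sub_le⟩ := abs_le.1 (near a ha)
  refine sq_le_sq' ?_ ?_ <;> nlinarith

lemma measureReal_le_l2SqEstimate_le (he : 0 < e) (he' : e ≤ 1 / 7) (hD : 2 ≤ D.card)
    (hm : EnoughSamples μ D e m) (near : ∀ a ∈ D, |μ.real {a} - avgMass μ D| ≤ e * avgMass μ D) :
    (iid (Fin m) μ).real {y | (2 * e) ^ 2 / D.card ≤ l2SqEstimate y D} ≤ 1 / 36 := by
  have hD' : D.Nonempty := Finset.card_pos.1 (by lia)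
  have sqDistUniform_le := sqDistUniform_le_of_near near
  have first_moment := sum_mul_sq_sub_threshold_le_of_near he.le he' near
  have hP := hm.measureReal_pos hD'
  have hA := hm.avgMass_pos hD'
  have hPA := card_mul_avgMass (μ := μ) (D := D)
  set A := avgMass μ D
  set P := μ.real D
  set V := sqDistUniform μ D
  set M := V - (2 * e) ^ 2 * (A * P) with hM
  replace sqDistUniform_le : V ≤ e ^ 2 * (A * P) :=
    sqDistUniform_le.trans_eq (by rw [← hPA]; ring)
  have hAP : 0 < e ^ 2 * (A * P) := by positivity
  have le_sq_mean : 9 * e ^ 4 * (A * P) ^ 2 ≤ M ^ 2 := by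
    nlinarith [show M ≤ -(3 * (e ^ 2 * (A * P))) by linarith]
  refine (measureReal_mono ?_).trans (measureReal_mul_pairSum_collisionKernel_nonpos_le hD
    (by positivity) (by nlinarith) (by linarith) hM (hm.two_le he he' hD')
    (first_moment.trans ?_) ?_)
  · exact fun y hy ↦
      mul_nonpos_of_nonpos_of_nonneg (by linarith) (pairSum_collisionKernel_nonneg hy)
  · calc P * (2 * e * A) ^ 2 = 4 * (e ^ 2 * A ^ 2 * P) := by ring
      _ ≤ m * P * e ^ 2 * (9 / 1000) * (e ^ 2 * A ^ 2 * P) := by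
          gcongr
          linarith [hm.le_mul hD']
      _ = m * (9 * e ^ 4 * (A * P) ^ 2) / 1000 := by ring
      _ ≤ m * M ^ 2 / 1000 := by gcongr
  · calc V + 2 * (A * P) ≤ 3 * (A * P) := by
          nlinarith [show 0 < A * P by positivity, show e ^ 2 ≤ 1 by nlinarith]
      _ ≤ m ^ 2 * e ^ 4 * (A * P) * (9 / 1000) * (A * P) := by
          gcongr
          linarith [hm.sq_mul_le hD']
      _ = m ^ 2 * (9 * e ^ 4 * (A * P) ^ 2) / 1000 := by ring
      _ ≤ m ^ 2 * M ^ 2 / 1000 := by gcongr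
      _ = (m * M) ^ 2 / 1000 := by ring

omit [IsProbabilityMeasure μ] in
lemma measureReal_singleton_sub_avgMass_le {a : Fin n} (ha : a ∈ D) :
    μ.real {a} - avgMass μ D ≤ √(sqDistUniform μ D) :=
  Real.le_sqrt_of_sq_le <|
    Finset.single_le_sum (f := fun b ↦ (μ.real {b} - avgMass μ D) ^ 2) (fun _ _ ↦ sq_nonneg _) ha

lemma sum_mul_sq_sub_threshold_le_of_far (he : 0 ≤ e) (he' : e ≤ 1 / 7)
    (far : 9 * e ^ 2 * (avgMass μ D * μ.real D) ≤ sqDistUniform μ D) :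
    ∑ a ∈ D, μ.real {a} * (μ.real {a} - (1 + (2 * e) ^ 2) * avgMass μ D) ^ 2 ≤
      (3 * avgMass μ D + 2 * √(sqDistUniform μ D)) * sqDistUniform μ D := by
  have hA : 0 ≤ avgMass μ D := avgMass_nonneg
  set A := avgMass μ D
  set V := sqDistUniform μ D
  have term_le : ∀ a ∈ D, μ.real {a} * (μ.real {a} - (1 + (2 * e) ^ 2) * A) ^ 2 ≤
      2 * (A + √V) * (μ.real {a} - A) ^ 2 + 2 * (4 * e ^ 2 * A) ^ 2 * μ.real {a} := fun a ha ↦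
    calc μ.real {a} * (μ.real {a} - (1 + (2 * e) ^ 2) * A) ^ 2
        ≤ μ.real {a} * (2 * (μ.real {a} - A) ^ 2 + 2 * (4 * e ^ 2 * A) ^ 2) := by
          gcongr
          linarith [sq_nonneg (μ.real {a} - A + 4 * e ^ 2 * A)]
      _ = 2 * μ.real {a} * (μ.real {a} - A) ^ 2 + 2 * (4 * e ^ 2 * A) ^ 2 * μ.real {a} := by ring
      _ ≤ _ := by
          gcongr
          linarith [measureReal_singleton_sub_avgMass_le (μ := μ) ha]
  calc ∑ a ∈ D, μ.real {a} * (μ.real {a} - (1 + (2 * e) ^ 2) * A) ^ 2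
      ≤ 2 * (A + √V) * V + 2 * (4 * e ^ 2 * A) ^ 2 * μ.real D := by
        rw [← sum_measureReal_singleton, Finset.mul_sum, show V = ∑ a ∈ D, _ from rfl,
          Finset.mul_sum, ← Finset.sum_add_distrib]
        exact Finset.sum_le_sum term_le
    _ = 2 * (A + √V) * V + 32 / 9 * e ^ 2 * A * (9 * e ^ 2 * (A * μ.real D)) := by ring
    _ ≤ 2 * (A + √V) * V + 1 * A * V := by
        gcongr
        nlinarith
    _ = _ := by ring

lemma measureReal_l2SqEstimate_lt_le (he : 0 < e) (he' : e ≤ 1 / 7) (hD : 2 ≤ D.card)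
    (hm : EnoughSamples μ D e m)
    (far : 9 * e ^ 2 * (avgMass μ D * μ.real D) ≤ sqDistUniform μ D) :
    (iid (Fin m) μ).real {y | l2SqEstimate y D < (2 * e) ^ 2 / D.card} ≤ 1 / 36 := by
  have hD' : D.Nonempty := Finset.card_pos.1 (by lia)
  have first_moment := sum_mul_sq_sub_threshold_le_of_far he.le he' far
  have hP := hm.measureReal_pos hD'
  have hA := hm.avgMass_pos hD'
  set A := avgMass μ D
  set P := μ.real D
  set V := sqDistUniform μ D
  set M := V - (2 * e) ^ 2 * (A * P) with hM
  have hV : 0 < V := far.trans_lt' (by positivity)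
  have le_sq_mean : 25 / 81 * V ^ 2 ≤ M ^ 2 := by nlinarith [show 5 / 9 * V ≤ M by linarith]
  have le_mul_dev := hm.avgMass_le_mul_sqDistUniform hD' far
  have le_sq_mul_dev := hm.le_sq_mul_sqDistUniform hD' far
  have sqrt_dev_le : 30000 * √V ≤ m * V := by
    have le_mul_sqrt_dev : 30000 ≤ m * √V := by
      refine le_of_sq_le_sq ?_ (by positivity)
      rw [mul_pow, Real.sq_sqrt hV.le]
      nlinarith [show 0 ≤ m ^ 2 * V by positivity, show e ^ 2 ≤ 1 by nlinarith]
    calc 30000 * √V ≤ m * √V * √V := by gcongr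
      _ = m * V := by rw [mul_assoc, Real.mul_self_sqrt hV.le]
  refine (measureReal_mono ?_).trans (measureReal_mul_pairSum_collisionKernel_nonpos_le hD
    (by positivity) (by nlinarith) (by linarith) hM (hm.two_le he he' hD')
    (first_moment.trans ?_) ?_)
  · exact fun y hy ↦ mul_nonpos_of_nonneg_of_nonpos (by linarith)
      (pairSum_collisionKernel_nonpos hy)
  · calc (3 * A + 2 * √V) * V ≤ 1 / 10000 * (m * V) * V := by
          gcongr
          linarith
      _ ≤ m * (25 / 81 * V ^ 2) / 1000 := by nlinarith [show 0 ≤ m * V ^ 2 by positivity]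
      _ ≤ m * M ^ 2 / 1000 := by gcongr
  · calc V + 2 * (A * P) ≤ V / e ^ 2 := by
          rw [le_div_iff₀ (by positivity)]
          nlinarith [show e ^ 2 ≤ 1 / 49 by nlinarith]
      _ ≤ m ^ 2 * e ^ 2 * V * (25 / 81) / 1000 * (V / e ^ 2) := by
          refine le_mul_of_one_le_left (by positivity) ?_
          linarith
      _ = m ^ 2 * (25 / 81 * V ^ 2) / 1000 := by field_simp
      _ ≤ m ^ 2 * M ^ 2 / 1000 := by gcongr
      _ = (m * M) ^ 2 / 1000 := by ring

end CollisionTest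

/-! ### Buckets and pieces -/

section Buckets

variable {n : ℕ} {q : Fin n → ℝ} {η : ℝ} {i j : ℕ} {x : Fin n}

lemma mem_bucket_iff (hη : 0 < η) :
    x ∈ bucket q η j ↔
      q x ≤ (1 + η) ^ j * η ^ 2 / n ∧ ∀ i < j, (1 + η) ^ i * η ^ 2 / n < q x := by
  cases j with
  | zero => simp [bucket]
  | succ j =>
    simp only [bucket, Finset.mem_filter, Finset.mem_univ, true_and]
    refine ⟨fun h ↦ ⟨h.2, fun i hi ↦ lt_of_le_of_lt ?_ h.1⟩, fun h ↦ ⟨h.2 j j.lt_succ_self, h.1⟩⟩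
    gcongr
    · linarith
    · exact Nat.le_of_lt_succ hi

lemma bucket_unique (hη : 0 < η) (hi : x ∈ bucket q η i) (hj : x ∈ bucket q η j) : i = j := by
  rw [mem_bucket_iff hη] at hi hj
  rcases lt_trichotomy i j with h | h | h
  · exact absurd hi.1 (not_le.2 (hj.2 i h))
  · exact h
  · exact absurd hj.1 (not_le.2 (hi.2 j h))

lemma numBuckets_pos (n : ℕ) (η : ℝ) : 0 < numBuckets n η := Nat.succ_pos _

lemma exists_mem_bucket (hη : 0 < η) (hx : q x ≤ 1) : ∃ j < numBuckets n η, x ∈ bucket q η j := by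
  have hn : (0 : ℝ) < n := by exact_mod_cast Fin.pos x
  set v := ⌈Real.log (n / η ^ 2) / Real.log (1 + η)⌉₊
  have le_top : q x ≤ (1 + η) ^ v * η ^ 2 / n := by
    have log_le : Real.log (n / η ^ 2) ≤ v * Real.log (1 + η) :=
      (div_le_iff₀ (Real.log_pos (by linarith))).1 (Nat.le_ceil _)
    rw [← Real.log_pow, Real.log_le_log_iff (by positivity) (by positivity),
      div_le_iff₀ (by positivity)] at log_le
    exact hx.trans (by rwa [le_div_iff₀ hn, one_mul])
  have exists_le : ∃ j, q x ≤ (1 + η) ^ j * η ^ 2 / n := ⟨v, le_top⟩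
  exact ⟨Nat.find exists_le, Nat.lt_succ_of_le (Nat.find_min' exists_le le_top),
    (mem_bucket_iff hη).2
      ⟨Nat.find_spec exists_le, fun i hi ↦ not_le.1 (Nat.find_min exists_le hi)⟩⟩

end Buckets

section Pieces

variable {n t l : ℕ} {S : Finset (Fin n)} {x y z : Fin n}

/-- The number of elements of `S` before `x`. -/
def rankIn (S : Finset (Fin n)) (x : Fin n) : ℕ := Finset.card {y ∈ S | y < x}

lemma mem_piece : x ∈ piece t S l ↔ x ∈ S ∧ rankIn S x * numPieces n t S.card / S.card = l := by
  simp [piece, rankIn]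

lemma piece_subset : piece t S l ⊆ S := Finset.filter_subset _ _

lemma rankIn_mono (S : Finset (Fin n)) : Monotone (rankIn S) := fun _ _ h ↦
  Finset.card_le_card (Finset.monotone_filter_right S fun _ _ hz ↦ hz.trans_le h)

lemma strictMonoOn_rankIn (S : Finset (Fin n)) : StrictMonoOn (rankIn S) S := by
  refine fun x hx y _ hxy ↦ Finset.card_lt_card
    ⟨Finset.monotone_filter_right S fun _ _ hz ↦ hz.trans hxy, fun hsub ↦ ?_⟩
  simpa using hsub (Finset.mem_filter.2 ⟨hx, hxy⟩)

lemma rankIn_lt_card (hx : x ∈ S) : rankIn S x < S.card :=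
  Finset.card_lt_card (Finset.filter_ssubset.2 ⟨x, hx, lt_irrefl x⟩)

lemma numPieces_pos (n t z : ℕ) : 0 < numPieces n t z := by
  unfold numPieces
  split_ifs <;> positivity

lemma mul_numPieces_le (n t z : ℕ) : n * numPieces n t z ≤ z * t + n := by
  unfold numPieces
  split_ifs
  · rw [mul_add, mul_one]
    exact Nat.add_le_add_right (Nat.mul_div_le _ _) _
  · lia

lemma le_numPieces_mul_ceil (hn : 0 < n) (ht : 0 < t) (z : ℕ) :
    z ≤ numPieces n t z * ⌈(n : ℝ) / t⌉₊ := by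
  unfold numPieces
  split_ifs with hz
  · have le_ceil_mul : n ≤ ⌈(n : ℝ) / t⌉₊ * t := by
      exact_mod_cast (div_le_iff₀ (by positivity)).1 (Nat.le_ceil ((n : ℝ) / t))
    refine (lt_of_mul_lt_mul_right ?_ t.zero_le).le
    calc z * t < (z * t / n + 1) * n := by
          rw [mul_comm _ n]
          exact Nat.lt_mul_div_succ _ hn
      _ ≤ (z * t / n + 1) * (⌈(n : ℝ) / t⌉₊ * t) := Nat.mul_le_mul_left _ le_ceil_mul
      _ = (z * t / n + 1) * ⌈(n : ℝ) / t⌉₊ * t := by ring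
  · lia

lemma exists_mem_piece (t : ℕ) (hx : x ∈ S) : ∃ l < numPieces n t S.card, x ∈ piece t S l := by
  refine ⟨_, ?_, mem_piece.2 ⟨hx, rfl⟩⟩
  rw [Nat.div_lt_iff_lt_mul (Finset.card_pos.2 ⟨x, hx⟩), mul_comm]
  exact Nat.mul_lt_mul_of_pos_left (rankIn_lt_card hx) (numPieces_pos _ _ _)

lemma mem_piece_of_mem_Icc (hx : x ∈ piece t S l) (hy : y ∈ piece t S l) (hz : z ∈ S)
    (hxyz : z ∈ Finset.Icc x y) : z ∈ piece t S l := by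
  rw [mem_piece] at *
  rw [Finset.mem_Icc] at hxyz
  refine ⟨hz, le_antisymm ?_ ?_⟩
  · rw [← hy.2]
    gcongr
    exact rankIn_mono S hxyz.2
  · rw [← hx.2]
    gcongr
    exact rankIn_mono S hxyz.1

lemma rankIn_lt_add {M : ℕ} (hS : S.card ≤ numPieces n t S.card * M) (hx : x ∈ piece t S l)
    (hy : y ∈ piece t S l) : rankIn S y < rankIn S x + M := by
  have card_pos : 0 < S.card := Finset.card_pos.2 ⟨x, piece_subset hx⟩
  rw [mem_piece] at hx hy
  set L := numPieces n t S.card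
  refine lt_of_mul_lt_mul_right (a := L) ?_ L.zero_le
  calc rankIn S y * L < (l + 1) * S.card := by
        rw [← Nat.div_lt_iff_lt_mul card_pos, hy.2]
        exact l.lt_succ_self
    _ = l * S.card + S.card := by ring
    _ ≤ rankIn S x * L + L * M := by
        exact Nat.add_le_add ((Nat.le_div_iff_mul_le card_pos).1 hx.2.ge) hS
    _ = (rankIn S x + M) * L := by ring

lemma card_piece_le (ht : 0 < t) (S : Finset (Fin n)) (l : ℕ) :
    (piece t S l).card ≤ ⌈(n : ℝ) / t⌉₊ := by
  rcases (piece t S l).eq_empty_or_nonempty with he | hne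
  · simp [he]
  set x := (piece t S l).min' hne
  have hx : x ∈ piece t S l := Finset.min'_mem _ _
  rw [← Finset.card_image_of_injOn ((strictMonoOn_rankIn S).injOn.mono piece_subset)]
  have image_subset : (piece t S l).image (rankIn S) ⊆
      Finset.Ico (rankIn S x) (rankIn S x + ⌈(n : ℝ) / t⌉₊) :=
    Finset.image_subset_iff.2 fun y hy ↦ Finset.mem_Ico.2
      ⟨rankIn_mono S (Finset.min'_le _ _ hy),
        rankIn_lt_add (le_numPieces_mul_ceil (Fin.pos x) ht _) hx hy⟩
  simpa using Finset.card_le_card image_subset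

end Pieces

/-! ### The refined division -/

section IsDivision

variable {α : Type*} {𝒟 : Finset (Finset α)}

/-- A partition of the domain that may have `∅` as a member, such as a refined division (this is
why it is not a `Finpartition`). -/
structure IsDivision (𝒟 : Finset (Finset α)) : Prop where
  pairwiseDisjoint : (𝒟 : Set (Finset α)).PairwiseDisjoint id
  exists_mem : ∀ x, ∃ D ∈ 𝒟, x ∈ D

namespace IsDivision

variable [Fintype α]

lemma sum_sum {M : Type*} [AddCommMonoid M] (h𝒟 : IsDivision 𝒟) (f : α → M) :
    ∑ D ∈ 𝒟, ∑ x ∈ D, f x = ∑ x, f x := by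
  have biUnion_eq : 𝒟.biUnion id = Finset.univ :=
    Finset.eq_univ_of_forall fun x ↦ by simpa using h𝒟.exists_mem x
  rw [← biUnion_eq, Finset.sum_biUnion h𝒟.pairwiseDisjoint]
  rfl

lemma card_le (h𝒟 : IsDivision 𝒟) : 𝒟.card ≤ Fintype.card α + 1 := by
  have card_erase_le : (𝒟.erase ∅).card ≤ ((𝒟.erase ∅).biUnion id).card :=
    Finset.card_le_card_biUnion
      (h𝒟.pairwiseDisjoint.subset (Finset.coe_subset.2 (Finset.erase_subset _ _)))
      fun D hD ↦ Finset.nonempty_iff_ne_empty.2 (Finset.ne_of_mem_erase hD)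
  have := Finset.pred_card_le_card_erase (s := 𝒟) (a := ∅)
  have := Finset.card_le_univ ((𝒟.erase ∅).biUnion id)
  lia

end IsDivision

end IsDivision

section RefinedDivision

variable {n k : ℕ} {I : Segmentation n k} {q : Fin n → ℝ} {η : ℝ} {D : Finset (Fin n)}

lemma mem_refinedDivision : D ∈ refinedDivision I q η ↔
    ∃ i, ∃ j < numBuckets n η,
      ∃ l < numPieces n (k * numBuckets n η) (I.part i ∩ bucket q η j).card,
        piece (k * numBuckets n η) (I.part i ∩ bucket q η j) l = D := by
  simp [refinedDivision]

lemma exists_subset_of_mem_refinedDivision (hD : D ∈ refinedDivision I q η) :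
    ∃ i j, D ⊆ I.part i ∧ D ⊆ bucket q η j := by
  obtain ⟨i, j, -, l, -, rfl⟩ := mem_refinedDivision.1 hD
  exact ⟨i, j, Finset.subset_inter_iff.1 piece_subset⟩

lemma Segmentation.IsFlatOn.eq_of_mem_refinedDivision {f : Fin n → ℝ} (hf : I.IsFlatOn f)
    (hD : D ∈ refinedDivision I q η) : ∀ a ∈ D, ∀ b ∈ D, f a = f b :=
  have ⟨i, _, subset_part, _⟩ := exists_subset_of_mem_refinedDivision hD
  fun a ha b hb ↦ hf i a (subset_part ha) b (subset_part hb)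

lemma Segmentation.part_unique (I : Segmentation n k) {x : Fin n} {i j : Fin k}
    (hi : x ∈ I.part i) (hj : x ∈ I.part j) : i = j :=
  by_contra fun hne ↦ Finset.disjoint_left.1 (I.disjoint i j hne) hi hj

lemma isDivision_refinedDivision (I : Segmentation n k) (hη : 0 < η) (hq : ∀ x, q x ≤ 1) :
    IsDivision (refinedDivision I q η) where
  pairwiseDisjoint := by
    refine fun D hD D' hD' hne ↦ Finset.disjoint_left.2 fun x hx hx' ↦ hne ?_
    obtain ⟨i, j, -, l, -, rfl⟩ := mem_refinedDivision.1 hD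
    obtain ⟨i', j', -, l', -, rfl⟩ := mem_refinedDivision.1 hD'
    rw [id, mem_piece, Finset.mem_inter] at hx hx'
    obtain rfl := I.part_unique hx.1.1 hx'.1.1
    obtain rfl := bucket_unique hη hx.1.2 hx'.1.2
    rw [← hx.2, ← hx'.2]
  exists_mem x := by
    obtain ⟨i, hi⟩ := I.cover x
    obtain ⟨j, hj, hxj⟩ := exists_mem_bucket hη (hq x)
    obtain ⟨l, hl, hxl⟩ := exists_mem_piece (k * numBuckets n η) (Finset.mem_inter.2 ⟨hi, hxj⟩)
    exact ⟨_, mem_refinedDivision.2 ⟨i, j, hj, l, hl, rfl⟩, hxl⟩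

lemma sum_card_part_inter_bucket_le (I : Segmentation n k) (q : Fin n → ℝ) (hη : 0 < η) (v : ℕ) :
    ∑ i, ∑ j ∈ Finset.range v, (I.part i ∩ bucket q η j).card ≤ n :=
  calc ∑ i, ∑ j ∈ Finset.range v, (I.part i ∩ bucket q η j).card
      ≤ ∑ i, (I.part i).card := by
        refine Finset.sum_le_sum fun i _ ↦ ?_
        rw [← Finset.card_biUnion fun j _ j' _ hne ↦ Finset.disjoint_left.2 fun x hx hx' ↦
          hne (bucket_unique hη (Finset.mem_inter.1 hx).2 (Finset.mem_inter.1 hx').2)]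
        exact Finset.card_le_card (Finset.biUnion_subset.2 fun _ _ ↦ Finset.inter_subset_left)
    _ = (Finset.univ.biUnion I.part).card :=
        (Finset.card_biUnion fun i _ j _ hne ↦ I.disjoint i j hne).symm
    _ ≤ n := by simpa using Finset.card_le_univ (Finset.univ.biUnion I.part)

lemma card_refinedDivision_le (I : Segmentation n k) (q : Fin n → ℝ) (hn : 0 < n) (hη : 0 < η) :
    (refinedDivision I q η).card ≤ 2 * (k * numBuckets n η) := by
  set v := numBuckets n η
  set t := k * v with ht
  have card_le_sum : (refinedDivision I q η).card ≤
      ∑ i, ∑ j ∈ Finset.range v, numPieces n t (I.part i ∩ bucket q η j).card :=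
    Finset.card_biUnion_le.trans <| Finset.sum_le_sum fun i _ ↦
      Finset.card_biUnion_le.trans <| Finset.sum_le_sum fun j _ ↦
        Finset.card_image_le.trans_eq (Finset.card_range _)
  refine Nat.le_of_mul_le_mul_left ((Nat.mul_le_mul_left n card_le_sum).trans ?_) hn
  calc n * ∑ i, ∑ j ∈ Finset.range v, numPieces n t (I.part i ∩ bucket q η j).card
      ≤ ∑ i, ∑ j ∈ Finset.range v, ((I.part i ∩ bucket q η j).card * t + n) := by
        simp_rw [Finset.mul_sum]
        gcongr
        exact mul_numPieces_le _ _ _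
    _ = (∑ i, ∑ j ∈ Finset.range v, (I.part i ∩ bucket q η j).card) * t + t * n := by
        simp [Finset.sum_add_distrib, Finset.sum_mul, ht, mul_assoc]
    _ ≤ n * t + t * n := by
        gcongr
        exact sum_card_part_inter_bucket_le I q hη v
    _ = n * (2 * t) := by ring

lemma lt_and_card_mul_le_of_mem_refinedDivision (hk : 0 < k) (hD : D ∈ refinedDivision I q η)
    (two_le : 2 ≤ D.card) :
    k * numBuckets n η < n ∧ D.card * (k * numBuckets n η) ≤ 2 * n := by
  obtain ⟨i, j, -, l, -, rfl⟩ := mem_refinedDivision.1 hD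
  have ht : 0 < k * numBuckets n η := Nat.mul_pos hk (numBuckets_pos _ _)
  have card_le := card_piece_le ht (I.part i ∩ bucket q η j) l
  set t := k * numBuckets n η
  set d := (piece t (I.part i ∩ bucket q η j) l).card
  have ht' : (0 : ℝ) < t := by exact_mod_cast ht
  have lt : (t : ℝ) < n := by
    rw [← one_lt_div ht', ← Nat.cast_one, ← Nat.lt_ceil]
    exact two_le.trans card_le
  have card_mul_le : (d : ℝ) * t ≤ 2 * n :=
    calc (d : ℝ) * t ≤ (n / t + 1) * t := by
          gcongr
          exact (Nat.cast_le.2 card_le).trans (Nat.ceil_lt_add_one (by positivity)).le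
      _ = n + t := by field_simp
      _ ≤ 2 * n := by linarith
  exact ⟨by exact_mod_cast lt, by exact_mod_cast card_mul_le⟩

/-- The sets of the refined divisions of all segmentations are among these: they depend on `q` and
`η` only, and there are so few of them that union bounds over all segmentations are affordable. -/
def runs (q : Fin n → ℝ) (η : ℝ) : Finset (Finset (Fin n)) :=
  insert ∅ <| Finset.univ.image fun ab : Fin n × Fin n ↦
    {z ∈ Finset.Icc ab.1 ab.2 | ∀ j, z ∈ bucket q η j ↔ ab.1 ∈ bucket q η j}

lemma card_runs_le (q : Fin n → ℝ) (η : ℝ) : (runs q η).card ≤ n ^ 2 + 1 :=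
  (Finset.card_insert_le _ _).trans <|
    Nat.add_le_add_right (Finset.card_image_le.trans_eq (by simp [sq])) 1

lemma refinedDivision_subset_runs (I : Segmentation n k) (q : Fin n → ℝ) (hη : 0 < η) :
    refinedDivision I q η ⊆ runs q η := by
  intro D hD
  rcases D.eq_empty_or_nonempty with rfl | hne
  · exact Finset.mem_insert_self _ _
  refine Finset.mem_insert_of_mem <|
    Finset.mem_image.2 ⟨(D.min' hne, D.max' hne), Finset.mem_univ _, ?_⟩
  have ha := D.min'_mem hne
  have hb := D.max'_mem hne
  have subset_Icc : D ⊆ Finset.Icc (D.min' hne) (D.max' hne) := fun z hz ↦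
    Finset.mem_Icc.2 ⟨D.min'_le z hz, D.le_max' z hz⟩
  set a := D.min' hne
  set b := D.max' hne
  obtain ⟨i, j, -, l, -, rfl⟩ := mem_refinedDivision.1 hD
  have mem_inter {z} (hz : z ∈ piece (k * numBuckets n η) (I.part i ∩ bucket q η j) l) :=
    Finset.mem_inter.1 (piece_subset hz)
  ext z
  rw [Finset.mem_filter]
  constructor
  · rintro ⟨hz, same_bucket⟩
    refine mem_piece_of_mem_Icc ha hb (Finset.mem_inter.2 ⟨?_, ?_⟩) hz
    · exact (I.ordConnected i).out (mem_inter ha).1 (mem_inter hb).1 (Finset.mem_Icc.1 hz)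
    · exact (same_bucket j).2 (mem_inter ha).2
  · refine fun hz ↦ ⟨subset_Icc hz, fun j' ↦ ⟨fun h ↦ ?_, fun h ↦ ?_⟩⟩
    · exact bucket_unique hη (mem_inter hz).2 h ▸ (mem_inter ha).2
    · exact bucket_unique hη (mem_inter ha).2 h ▸ (mem_inter hz).2

end RefinedDivision

/-! ### The overall shape of the sample -/

section CoarseDist

variable {n s : ℕ} {𝒟 : Finset (Finset (Fin n))}

lemma coarseDist_comm (𝒟 : Finset (Finset (Fin n))) (f g : Fin n → ℝ) :
    coarseDist 𝒟 f g = coarseDist 𝒟 g f :=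
  Finset.sum_congr rfl fun _ _ ↦ abs_sub_comm _ _

lemma coarseDist_triangle (𝒟 : Finset (Finset (Fin n))) (f g h : Fin n → ℝ) :
    coarseDist 𝒟 f h ≤ coarseDist 𝒟 f g + coarseDist 𝒟 g h := by
  rw [coarseDist, coarseDist, coarseDist, ← Finset.sum_add_distrib]
  exact Finset.sum_le_sum fun D _ ↦ abs_sub_le _ _ _

lemma IsDivision.coarseDist_le_l1Dist (h𝒟 : IsDivision 𝒟) (f g : Fin n → ℝ) :
    coarseDist 𝒟 f g ≤ l1Dist f g := by
  rw [l1Dist, ← h𝒟.sum_sum]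
  refine Finset.sum_le_sum fun D _ ↦ ?_
  rw [← Finset.sum_sub_distrib]
  exact Finset.abs_sum_le_sum_abs _ _

lemma IsDivision.abs_sum_sub_sum_le_coarseDist (h𝒟 : IsDivision 𝒟) (f g : Fin n → ℝ) :
    |∑ a, f a - ∑ a, g a| ≤ coarseDist 𝒟 f g := by
  rw [← h𝒟.sum_sum, ← h𝒟.sum_sum, ← Finset.sum_sub_distrib]
  exact Finset.abs_sum_le_sum_abs _ _

lemma sum_empirical (x : Fin s → Fin n) (A : Finset (Fin n)) :
    ∑ a ∈ A, empirical x a = (countIn x A : ℝ) / s := by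
  have countIn_eq_sum : countIn x A = ∑ a ∈ A, countIn x {a} := by
    simp only [countIn, Finset.card_filter, Finset.mem_singleton]
    rw [Finset.sum_comm]
    simp
  rw [countIn_eq_sum, Nat.cast_sum, Finset.sum_div]
  rfl

lemma sum_empirical_univ (hs : 0 < s) (x : Fin s → Fin n) : ∑ a, empirical x a = 1 := by
  rw [sum_empirical]
  simp [countIn, hs.ne']

lemma sum_abs_eq_two_mul_sum_nonneg {ι : Type*} {S : Finset ι} {Δ : ι → ℝ}
    (hΔ : ∑ i ∈ S, Δ i = 0) : ∑ i ∈ S, |Δ i| = 2 * ∑ i ∈ S with 0 ≤ Δ i, Δ i := by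
  have abs_eq (y : ℝ) : |y| = 2 * (if 0 ≤ y then y else 0) - y := by
    split_ifs with hy
    · rw [abs_of_nonneg hy]
      ring
    · rw [abs_of_neg (not_le.1 hy)]
      ring
  simp_rw [abs_eq, Finset.sum_sub_distrib, hΔ, sub_zero, ← Finset.mul_sum, Finset.sum_filter]

/-- Both arguments have the same total, so that it suffices to bound the surplus of the sample. -/
lemma IsDivision.coarseDist_empirical_le (h𝒟 : IsDivision 𝒟) (hs : 0 < s) {x : Fin s → Fin n}
    {p : Fin n → ℝ} (hp : ∑ a, p a = 1) {c : ℝ}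
    (hx : ∀ 𝒜 ⊆ 𝒟, (countIn x (𝒜.biUnion id) : ℝ) ≤ s * (∑ a ∈ 𝒜.biUnion id, p a + c)) :
    coarseDist 𝒟 (empirical x) p ≤ 2 * c := by
  set Δ : Finset (Fin n) → ℝ := fun D ↦ ∑ a ∈ D, empirical x a - ∑ a ∈ D, p a
  set 𝒜 := 𝒟.filter fun D ↦ 0 ≤ Δ D
  have disjoint_𝒜 : (𝒜 : Set (Finset (Fin n))).PairwiseDisjoint id :=
    h𝒟.pairwiseDisjoint.subset (Finset.coe_subset.2 (Finset.filter_subset _ _))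
  have surplus_le : ∑ D ∈ 𝒜, Δ D ≤ c := by
    have count_le := hx 𝒜 (Finset.filter_subset _ _)
    rw [mul_comm, ← div_le_iff₀ (by exact_mod_cast hs), ← sum_empirical,
      Finset.sum_biUnion disjoint_𝒜, Finset.sum_biUnion disjoint_𝒜, ← sub_le_iff_le_add',
      ← Finset.sum_sub_distrib] at count_le
    exact count_le
  have total_eq_zero : ∑ D ∈ 𝒟, Δ D = 0 := by
    rw [Finset.sum_sub_distrib, h𝒟.sum_sum, h𝒟.sum_sum, sum_empirical_univ hs, hp, sub_self]
  calc coarseDist 𝒟 (empirical x) p = 2 * ∑ D ∈ 𝒜, Δ D :=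
        sum_abs_eq_two_mul_sum_nonneg total_eq_zero
    _ ≤ 2 * c := by gcongr

end CoarseDist

section Unions

variable {α : Type*} [DecidableEq α] {𝒜 ℛ : Finset (Finset α)} {N : ℕ}

/-- The unions of `N` members of `ℛ`, repetitions allowed; these are the sets over which the union
bound for the overall shape runs. -/
def unions (ℛ : Finset (Finset α)) (N : ℕ) : Finset (Finset α) :=
  (Fintype.piFinset fun _ : Fin N ↦ ℛ).image fun u ↦ Finset.univ.biUnion u

lemma card_unions_le (ℛ : Finset (Finset α)) (N : ℕ) : (unions ℛ N).card ≤ ℛ.card ^ N :=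
  Finset.card_image_le.trans_eq (by simp)

lemma biUnion_mem_unions (empty_mem : ∅ ∈ ℛ) (subset : 𝒜 ⊆ ℛ) (card_le : 𝒜.card ≤ N) :
    𝒜.biUnion id ∈ unions ℛ N := by
  obtain ⟨φ⟩ : Nonempty (𝒜 ↪ Fin N) := Function.Embedding.nonempty_of_card_le (by simpa)
  refine Finset.mem_image.2 ⟨Function.extend φ Subtype.val fun _ ↦ ∅, ?_, ?_⟩
  · refine Fintype.mem_piFinset.2 fun i ↦ ?_
    by_cases hi : ∃ A, φ A = i
    · obtain ⟨A, rfl⟩ := hi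
      rw [φ.injective.extend_apply]
      exact subset A.2
    · rwa [Function.extend_apply' _ _ _ hi]
  · ext a
    simp only [Finset.mem_biUnion, Finset.mem_univ, true_and, id]
    constructor
    · rintro ⟨i, ha⟩
      by_cases hi : ∃ A, φ A = i
      · obtain ⟨A, rfl⟩ := hi
        rw [φ.injective.extend_apply] at ha
        exact ⟨A, A.2, ha⟩
      · rw [Function.extend_apply' _ _ _ hi] at ha
        exact absurd ha (Finset.notMem_empty a)
    · rintro ⟨A, hA, ha⟩
      exact ⟨φ ⟨A, hA⟩, by rwa [φ.injective.extend_apply]⟩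

end Unions

lemma measureReal_biUnion_le_card_mul {Ω ι : Type*} [MeasurableSpace Ω] {μ : Measure Ω}
    {S : Finset ι} {E : ι → Set Ω} {c : ℝ} (hE : ∀ i ∈ S, μ.real (E i) ≤ c) :
    μ.real (⋃ i ∈ S, E i) ≤ S.card * c :=
  (measureReal_biUnion_finset_le S E).trans <| by simpa using Finset.sum_le_card_nsmul S _ c hE

lemma measureReal_lt_coarseDist_le {n s N : ℕ} (μ : Measure (Fin n)) [IsProbabilityMeasure μ]
    {ℛ : Finset (Finset (Fin n))} (empty_mem : ∅ ∈ ℛ) (hs : 0 < s) {c : ℝ} (hc : 0 ≤ c) :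
    (iid (Fin s) μ).real {x | ∃ 𝒟 ⊆ ℛ, IsDivision 𝒟 ∧ 𝒟.card ≤ N ∧
      2 * c < coarseDist 𝒟 (empirical x) fun a ↦ μ.real {a}} ≤
      ℛ.card ^ N * Real.exp (-2 * s * c ^ 2) := by
  have event_subset : {x : Fin s → Fin n | ∃ 𝒟 ⊆ ℛ, IsDivision 𝒟 ∧ 𝒟.card ≤ N ∧
      2 * c < coarseDist 𝒟 (empirical x) fun a ↦ μ.real {a}} ⊆
      ⋃ U ∈ unions ℛ N, {x | s * (μ.real U + c) ≤ countIn x U} := by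
    rintro x ⟨𝒟, subset, h𝒟, card_le, hx⟩
    by_contra! hcon
    simp only [Set.mem_iUnion, Set.mem_ofPred_eq, not_exists, not_le] at hcon
    refine hx.not_ge (h𝒟.coarseDist_empirical_le hs (by simp) fun 𝒜 h𝒜 ↦ ?_)
    rw [sum_measureReal_singleton]
    exact (hcon _ (biUnion_mem_unions empty_mem (h𝒜.trans subset)
      ((Finset.card_le_card h𝒜).trans card_le))).le
  calc _ ≤ (iid (Fin s) μ).real (⋃ U ∈ unions ℛ N, {x | s * (μ.real U + c) ≤ countIn x U}) :=
        measureReal_mono event_subset (measure_ne_top _ _)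
    _ ≤ (unions ℛ N).card * Real.exp (-2 * s * c ^ 2) := by
        refine measureReal_biUnion_le_card_mul fun U _ ↦ ?_
        simpa [countIn_eq_hits] using
          measureReal_add_le_hits_le_exp (μ := μ) (ι := Fin s) U.measurableSet hc
    _ ≤ ℛ.card ^ N * Real.exp (-2 * s * c ^ 2) := by
        gcongr
        exact_mod_cast card_unions_le ℛ N

/-! ### Oscillation on the sets of a division -/

section Oscillation

variable {ι : Type*} {D : Finset ι} {f : ι → ℝ} {a : ι} {η : ℝ}

lemma abs_sub_expect_le {c : ℝ} (hf : ∀ b ∈ D, |f a - f b| ≤ c) (ha : a ∈ D) :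
    |f a - 𝔼 b ∈ D, f b| ≤ c :=
  calc |f a - 𝔼 b ∈ D, f b| = |𝔼 b ∈ D, (f a - f b)| := by
        rw [Finset.expect_sub_distrib, Finset.expect_const ⟨a, ha⟩]
    _ ≤ 𝔼 b ∈ D, |f a - f b| := Finset.abs_expect_le _ _
    _ ≤ c := Finset.expect_le ⟨a, ha⟩ hf

lemma abs_sub_expect_le_mul_expect (hη : 0 < η) (hf : ∀ a ∈ D, ∀ b ∈ D, f a ≤ (1 + η) * f b)
    (ha : a ∈ D) : |f a - 𝔼 b ∈ D, f b| ≤ η * 𝔼 b ∈ D, f b := by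
  have hf0 : ∀ b ∈ D, 0 ≤ f b := fun b hb ↦
    (mul_nonneg_iff_of_pos_left hη).1 (by linarith [hf b hb b hb])
  have : 0 ≤ 𝔼 b ∈ D, f b := Finset.expect_nonneg hf0
  have le_mean : f a ≤ (1 + η) * 𝔼 b ∈ D, f b := by
    rw [Finset.mul_expect]
    exact Finset.le_expect ⟨a, ha⟩ fun b hb ↦ hf a ha b hb
  have mean_le : 𝔼 b ∈ D, f b ≤ (1 + η) * f a := Finset.expect_le ⟨a, ha⟩ fun b hb ↦ hf b hb a ha
  rw [abs_le]
  constructor <;> nlinarith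

variable {n j : ℕ} {q f : Fin n → ℝ} {D : Finset (Fin n)} {a : Fin n} {α : ℝ}

lemma abs_sub_expect_le_of_subset_bucket (hη : 0 < η) (hq : 0 ≤ q) (hD : D ⊆ bucket q η j)
    (ha : a ∈ D) : |q a - 𝔼 b ∈ D, q b| ≤ max (η ^ 2 / n) (η * 𝔼 b ∈ D, q b) := by
  cases j with
  | zero =>
    have q_le : ∀ b ∈ D, q b ≤ η ^ 2 / n := fun b hb ↦ by simpa [bucket] using hD hb
    exact le_max_of_le_left <| abs_sub_expect_le (fun b hb ↦
      abs_sub_le_of_nonneg_of_le (hq a) (q_le a ha) (hq b) (q_le b hb)) ha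
  | succ j =>
    refine le_max_of_le_right (abs_sub_expect_le_mul_expect hη (fun a ha b hb ↦ ?_) ha)
    calc q a ≤ (1 + η) ^ (j + 1) * η ^ 2 / n := (Finset.mem_filter.1 (hD ha)).2.2
      _ = (1 + η) * ((1 + η) ^ j * η ^ 2 / n) := by ring
      _ ≤ (1 + η) * q b := by
          gcongr
          exact (Finset.mem_filter.1 (hD hb)).2.1.le

lemma mixture_sub_expect_mixture (hf : ∀ a ∈ D, ∀ b ∈ D, f a = f b) (ha : a ∈ D) :
    mixture α q f a - 𝔼 b ∈ D, mixture α q f b = (1 - α) * (q a - 𝔼 b ∈ D, q b) := by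
  have mean_eq : 𝔼 b ∈ D, f b = f a := by
    rw [Finset.expect_congr rfl fun b hb ↦ hf b hb a ha, Finset.expect_const ⟨a, ha⟩]
  simp_rw [mixture, Finset.expect_add_distrib, ← Finset.mul_expect, mean_eq]
  ring

lemma abs_mixture_sub_expect_mixture_le (hα : α ∈ Set.Icc (0 : ℝ) 1)
    (hf : ∀ a ∈ D, ∀ b ∈ D, f a = f b) (ha : a ∈ D) :
    |mixture α q f a - 𝔼 b ∈ D, mixture α q f b| ≤ |q a - 𝔼 b ∈ D, q b| := by
  rw [mixture_sub_expect_mixture hf ha, abs_mul, abs_of_nonneg (sub_nonneg.2 hα.2)]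
  exact mul_le_of_le_one_left (abs_nonneg _) (sub_le_self _ hα.1)

lemma abs_mixture_sub_expect_mixture_le_mul {e : ℝ} (hη : 0 < η) (hηe : η ≤ e) (hq : 0 ≤ q)
    (hf0 : 0 ≤ f) (hα : α ∈ Set.Icc (0 : ℝ) 1) (hD : D ⊆ bucket q η j)
    (hf : ∀ a ∈ D, ∀ b ∈ D, f a = f b) (heavy : η ^ 2 / n ≤ e * 𝔼 b ∈ D, mixture α q f b)
    (ha : a ∈ D) :
    |mixture α q f a - 𝔼 b ∈ D, mixture α q f b| ≤ e * 𝔼 b ∈ D, mixture α q f b := by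
  have hα' : 0 ≤ 1 - α := sub_nonneg.2 hα.2
  have mul_expect_le : (1 - α) * 𝔼 b ∈ D, q b ≤ 𝔼 b ∈ D, mixture α q f b := by
    rw [Finset.mul_expect]
    exact Finset.expect_le_expect fun b _ ↦ le_add_of_nonneg_right (mul_nonneg hα.1 (hf0 b))
  have expect_q_nonneg : 0 ≤ 𝔼 b ∈ D, q b := Finset.expect_nonneg fun b _ ↦ hq b
  rcases le_max_iff.1 (abs_sub_expect_le_of_subset_bucket hη hq hD ha) with tiny | relative
  · exact (abs_mixture_sub_expect_mixture_le hα hf ha).trans (tiny.trans heavy)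
  · calc |mixture α q f a - 𝔼 b ∈ D, mixture α q f b| = (1 - α) * |q a - 𝔼 b ∈ D, q b| := by
          rw [mixture_sub_expect_mixture hf ha, abs_mul, abs_of_nonneg hα']
      _ ≤ (1 - α) * (η * 𝔼 b ∈ D, q b) := by gcongr
      _ = η * ((1 - α) * 𝔼 b ∈ D, q b) := by ring
      _ ≤ e * 𝔼 b ∈ D, mixture α q f b :=
          mul_le_mul hηe mul_expect_le (mul_nonneg hα' expect_q_nonneg) (hη.le.trans hηe)

end Oscillation

/-! ### Majority votes of collision tests -/

section Majority

variable {n R m : ℕ} {μ : Measure (Fin n)} [IsProbabilityMeasure μ] {D : Finset (Fin n)} {e : ℝ}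

lemma measureReal_half_le_card_batch_le {E : Set (Fin m → Fin n)}
    (hE : (iid (Fin m) μ).real E ≤ 1 / 36) :
    (iid (Fin (R * m)) μ).real {x | R ≤ 2 * Finset.card {b : Fin R | batch x b ∈ E}} ≤
      (1 / 3) ^ R := by
  have majority := measureReal_half_le_hits_le (ι := Fin R) E.toFinite.measurableSet hE
  rw [← iid_real_curry μ finProdFinEquiv (Set.toFinite _).measurableSet] at majority
  simp only [Fintype.card_fin] at majority
  exact majority

lemma measureReal_looksNonuniform_le
    (h : (iid (Fin m) μ).real {y | (2 * e) ^ 2 / D.card ≤ l2SqEstimate y D} ≤ 1 / 36) :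
    (iid (Fin (R * m)) μ).real {x | LooksNonuniform e x D} ≤ (1 / 3) ^ R := by
  refine (measureReal_mono fun x hx ↦ ?_).trans (measureReal_half_le_card_batch_le h)
  have majority : LooksNonuniform e x D := hx
  simp only [Set.mem_ofPred_eq]
  convert majority.le

lemma measureReal_not_looksNonuniform_le
    (h : (iid (Fin m) μ).real {y | l2SqEstimate y D < (2 * e) ^ 2 / D.card} ≤ 1 / 36) :
    (iid (Fin (R * m)) μ).real {x | ¬ LooksNonuniform e x D} ≤ (1 / 3) ^ R := by
  refine (measureReal_mono fun x hx ↦ ?_).trans (measureReal_half_le_card_batch_le h)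
  have minority := not_lt.1 hx
  have card_add_card := Finset.card_filter_add_card_filter_not (s := (Finset.univ : Finset (Fin R)))
    fun b ↦ (2 * e) ^ 2 / (D.card : ℝ) ≤ l2SqEstimate (batch x b) D
  simp only [not_le, Finset.card_univ, Fintype.card_fin] at card_add_card
  simp only [Set.mem_ofPred_eq]
  lia

end Majority

/-! ### Reliability of the two tests -/

section Tests

variable {n k t R m : ℕ} {e δ η : ℝ} {q : Fin n → ℝ} {D : Finset (Fin n)}

/-- The uniformity test of the algorithm on the set `D`: unless `D` contains few samples, the
majority of the batches do not regard it as nonuniform. Here `e` is `ε'`. -/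
def PassesUniformityTest (e : ℝ) (t : ℕ) (x : Fin (R * m) → Fin n) (D : Finset (Fin n)) : Prop :=
  e * ((R * m : ℕ) : ℝ) / (4 * (t : ℝ)) ≤ (countIn x D : ℝ) → ¬ LooksNonuniform e x D

/-- What the analysis of the algorithm requires of the number `R` of batches and the size `m` of
a batch, given the accuracy `e = ε'` and the number `t` of intersections of intervals and buckets:
every single bad event has probability at most `δ`, and `δ` is small enough for a union bound over
the at most `n ^ 2 + 1` sets that occur in refined divisions. -/
structure SampleSizesSuffice (n t R m : ℕ) (e δ : ℝ) : Prop where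
  pos : 0 < R * m
  one_third_pow_le : (1 / 3 : ℝ) ^ R ≤ δ
  exp_threshold_le : t < n → Real.exp (-(e * ((R * m : ℕ) : ℝ) / (4 * t)) / 6) ≤ δ
  le_batch_size : ∀ d : ℕ, d * t ≤ 2 * n → 10000 * √(d : ℝ) ≤ m * (e / (8 * t)) * e ^ 2
  pow_mul_exp_le : ∀ N : ℕ, N ≤ n + 1 → N ≤ 2 * t →
    ((n : ℝ) ^ 2 + 1) ^ N * Real.exp (-2 * ((R * m : ℕ) : ℝ) * (e / 2) ^ 2) ≤ δ
  union_bound_le : (2 * (n : ℝ) ^ 2 + 3) * δ ≤ 1 / 3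

namespace SampleSizesSuffice

lemma nonneg (h : SampleSizesSuffice n t R m e δ) : 0 ≤ δ :=
  (by positivity : (0 : ℝ) ≤ (1 / 3) ^ R).trans h.one_third_pow_le

lemma enoughSamples {μ : Measure (Fin n)} (h : SampleSizesSuffice n t R m e δ)
    (hD : D.card * t ≤ 2 * n) (hμD : e / (8 * t) ≤ μ.real D) : EnoughSamples μ D e m :=
  (h.le_batch_size D.card hD).trans (by gcongr)

variable {μ : Measure (Fin n)} [IsProbabilityMeasure μ]

lemma measureReal_not_passesUniformityTest_le (h : SampleSizesSuffice n t R m e δ) (he : 0 < e)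
    (he' : e ≤ 1 / 7) (htn : t < n) (two_le : 2 ≤ D.card) (hD : D.card * t ≤ 2 * n)
    (near : e / (8 * t) ≤ μ.real D → ∀ a ∈ D, |μ.real {a} - avgMass μ D| ≤ e * avgMass μ D) :
    (iid (Fin (R * m)) μ).real {x | ¬ PassesUniformityTest e t x D} ≤ δ := by
  simp only [PassesUniformityTest, Classical.not_imp, not_not, countIn_eq_hits]
  rcases le_or_gt (e / (8 * t)) (μ.real D) with heavy | light
  · refine (measureReal_mono fun x hx ↦ hx.2).trans <|
      (measureReal_looksNonuniform_le ?_).trans h.one_third_pow_le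
    exact measureReal_le_l2SqEstimate_le he he' two_le (h.enoughSamples hD heavy) (near heavy)
  · refine (measureReal_mono fun x hx ↦ hx.1).trans <|
      (measureReal_le_hits_le_exp D.measurableSet ?_).trans (h.exp_threshold_le htn)
    rw [Fintype.card_fin]
    calc ((R * m : ℕ) : ℝ) * μ.real D ≤ ((R * m : ℕ) : ℝ) * (e / (8 * t)) := by gcongr
      _ = e * ((R * m : ℕ) : ℝ) / (4 * t) / 2 := by ring

lemma measureReal_passesUniformityTest_le (h : SampleSizesSuffice n t R m e δ) (he : 0 < e)
    (he' : e ≤ 1 / 7) (htn : t < n) (two_le : 2 ≤ D.card) (hD : D.card * t ≤ 2 * n)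
    (heavy : e / t ≤ μ.real D) (far : 9 * e ^ 2 * (avgMass μ D * μ.real D) ≤ sqDistUniform μ D) :
    (iid (Fin (R * m)) μ).real {x | PassesUniformityTest e t x D} ≤ 2 * δ := by
  set s : ℝ := ((R * m : ℕ) : ℝ)
  have few_hits : (iid (Fin (R * m)) μ).real {x | (hits D x : ℝ) < e * s / t / 4} ≤ δ := by
    refine (measureReal_hits_lt_le_exp D.measurableSet (by positivity) ?_).trans
      ((Real.exp_le_exp.2 ?_).trans (h.exp_threshold_le htn))
    · rw [Fintype.card_fin, mul_comm e, mul_div_assoc]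
      gcongr
    · have threshold_le : e * s / (4 * t) ≤ e * s / t := by
        rw [mul_comm 4, ← div_div]
        exact div_le_self (by positivity) (by norm_num)
      linarith
  have uniform_looking :
      (iid (Fin (R * m)) μ).real {x : Fin (R * m) → Fin n | ¬ LooksNonuniform e x D} ≤ δ := by
    refine (measureReal_not_looksNonuniform_le ?_).trans h.one_third_pow_le
    refine measureReal_l2SqEstimate_lt_le he he' two_le (h.enoughSamples hD (le_trans ?_ heavy)) far
    rw [mul_comm 8, ← div_div]
    exact div_le_self (by positivity) (by norm_num)
  calc (iid (Fin (R * m)) μ).real {x | PassesUniformityTest e t x D}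
      ≤ (iid (Fin (R * m)) μ).real ({x | (hits D x : ℝ) < e * s / t / 4} ∪
          {x | ¬ LooksNonuniform e x D}) := by
        refine measureReal_mono fun x hx ↦ or_iff_not_imp_left.2 fun many ↦ hx ?_
        rw [countIn_eq_hits]
        exact le_of_eq_of_le (by ring) (not_lt.1 many)
    _ ≤ 2 * δ := by
        rw [two_mul]
        exact (measureReal_union_le _ _).trans (add_le_add few_hits uniform_looking)

lemma measureReal_lt_coarseDist_refinedDivision_le
    (h : SampleSizesSuffice n (k * numBuckets n η) R m e δ) (he : 0 ≤ e) (hη : 0 < η)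
    (hn : 0 < n) (hq : ∀ a, q a ≤ 1) :
    (iid (Fin (R * m)) μ).real {x | ∃ I : Segmentation n k,
      e < coarseDist (refinedDivision I q η) (empirical x) fun a ↦ μ.real {a}} ≤ δ := by
  set N := min (n + 1) (2 * (k * numBuckets n η))
  calc _ ≤ (iid (Fin (R * m)) μ).real {x | ∃ 𝒟 ⊆ runs q η, IsDivision 𝒟 ∧ 𝒟.card ≤ N ∧
          2 * (e / 2) < coarseDist 𝒟 (empirical x) fun a ↦ μ.real {a}} := by
        refine measureReal_mono fun x ⟨I, hI⟩ ↦ ?_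
        have division := isDivision_refinedDivision I hη hq
        refine ⟨refinedDivision I q η, refinedDivision_subset_runs I q hη, division,
          le_min ?_ (card_refinedDivision_le I q hn hη), by rwa [mul_div_cancel₀ _ two_ne_zero]⟩
        simpa only [Fintype.card_fin] using division.card_le
    _ ≤ (runs q η).card ^ N * Real.exp (-2 * ((R * m : ℕ) : ℝ) * (e / 2) ^ 2) :=
        measureReal_lt_coarseDist_le μ (Finset.mem_insert_self _ _) h.pos (by positivity)
    _ ≤ ((n : ℝ) ^ 2 + 1) ^ N * Real.exp (-2 * ((R * m : ℕ) : ℝ) * (e / 2) ^ 2) := by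
        gcongr
        exact_mod_cast card_runs_le q η
    _ ≤ δ := h.pow_mul_exp_le N (min_le_left _ _) (min_le_right _ _)

end SampleSizesSuffice

end Tests

/-! ### Completeness -/

section Completeness

variable {n k t R m : ℕ} {e ε δ α : ℝ} {q r g : Fin n → ℝ} {D : Finset (Fin n)}
  {𝒟 : Finset (Finset (Fin n))}

lemma l2SqEstimate_nonpos_of_card_eq_one (hD : D.card = 1) (y : Fin m → Fin n) :
    l2SqEstimate y D ≤ 0 := by
  rw [l2SqEstimate, hD, Nat.cast_one, div_one, sub_nonpos]
  exact div_le_one_of_le₀ (mod_cast collisions_le_choose D y) (by positivity)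

lemma passesUniformityTest_of_card_le_one (he : 0 < e) (ht : 0 < t) (hs : 0 < R * m)
    (hD : D.card ≤ 1) (x : Fin (R * m) → Fin n) : PassesUniformityTest e t x D := by
  rcases Nat.le_one_iff_eq_zero_or_eq_one.1 hD with empty | singleton
  · intro le_count
    have threshold_pos : 0 < e * ((R * m : ℕ) : ℝ) / (4 * (t : ℝ)) := by positivity
    simp only [Finset.card_eq_zero.1 empty, countIn, Finset.notMem_empty, Finset.filter_false,
      Finset.card_empty, Nat.cast_zero] at le_count
    exact absurd le_count threshold_pos.not_ge
  · have estimate_lt (b : Fin R) : ¬ (2 * e) ^ 2 / (D.card : ℝ) ≤ l2SqEstimate (batch x b) D :=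
      not_le.2 ((l2SqEstimate_nonpos_of_card_eq_one singleton _).trans_lt
        (by rw [singleton]; positivity))
    simp [PassesUniformityTest, LooksNonuniform, estimate_lt]

lemma pos_of_mem_stdSimplex (hq : q ∈ stdSimplex ℝ (Fin n)) : 0 < n := by
  refine Nat.pos_of_ne_zero ?_
  rintro rfl
  simpa using hq.2

lemma mixture_mem_stdSimplex (hq : q ∈ stdSimplex ℝ (Fin n)) (hr : r ∈ stdSimplex ℝ (Fin n))
    (hα : α ∈ Set.Icc (0 : ℝ) 1) : mixture α q r ∈ stdSimplex ℝ (Fin n) :=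
  convex_stdSimplex ℝ (Fin n) hq hr (sub_nonneg.2 hα.2) hα.1 (sub_add_cancel _ _)

lemma l1Dist_mixture_le (hq : q ∈ stdSimplex ℝ (Fin n)) (hr : r ∈ stdSimplex ℝ (Fin n))
    (α β : ℝ) : l1Dist (mixture α q r) (mixture β q r) ≤ 2 * |α - β| := by
  calc l1Dist (mixture α q r) (mixture β q r) = ∑ a, |α - β| * |r a - q a| := by
        simp_rw [l1Dist, ← abs_mul, mixture]
        exact Finset.sum_congr rfl fun a _ ↦ congrArg _ (by ring)
    _ ≤ ∑ a, |α - β| * (r a + q a) := by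
        gcongr with a
        simpa only [abs_of_nonneg (hr.1 a), abs_of_nonneg (hq.1 a)] using abs_sub (r a) (q a)
    _ = 2 * |α - β| := by
        rw [← Finset.mul_sum, Finset.sum_add_distrib, hq.2, hr.2]
        ring

lemma exists_alphaGrid_near (he : 0 < e) (hα : α ∈ Set.Icc (0 : ℝ) 1) :
    ∃ β ∈ alphaGrid e, |α - β| < e / 2 := by
  have floor_le : ⌊α / (e / 2)⌋₊ * (e / 2) ≤ α :=
    (le_div_iff₀ (by positivity)).1 (Nat.floor_le (div_nonneg hα.1 (by positivity)))
  have lt_floor : α < (⌊α / (e / 2)⌋₊ + 1) * (e / 2) :=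
    (div_lt_iff₀ (by positivity)).1 (Nat.lt_floor_add_one _)
  refine ⟨_, Or.inr ⟨floor_le.trans hα.2, _, rfl⟩, ?_⟩
  rw [abs_of_nonneg (sub_nonneg.2 floor_le)]
  linarith

lemma IsDivision.exists_alphaGrid_coarseDist_lt (h𝒟 : IsDivision 𝒟) (he : 0 < e)
    (hq : q ∈ stdSimplex ℝ (Fin n)) (hr : r ∈ stdSimplex ℝ (Fin n)) (hα : α ∈ Set.Icc (0 : ℝ) 1)
    (close : coarseDist 𝒟 g (mixture α q r) ≤ e) :
    ∃ β ∈ alphaGrid e, coarseDist 𝒟 g (mixture β q r) < 2 * e := by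
  obtain ⟨β, hβ, near⟩ := exists_alphaGrid_near he hα
  refine ⟨β, hβ, ?_⟩
  calc coarseDist 𝒟 g (mixture β q r)
      ≤ coarseDist 𝒟 g (mixture α q r) + coarseDist 𝒟 (mixture α q r) (mixture β q r) :=
        coarseDist_triangle _ _ _ _
    _ ≤ e + 2 * |α - β| := by
        gcongr
        exact (h𝒟.coarseDist_le_l1Dist _ _).trans (l1Dist_mixture_le hq hr α β)
    _ < 2 * e := by linarith

lemma le_mul_avgMass {μ : Measure (Fin n)} [IsFiniteMeasure μ] (he : 0 < e) (ht : 0 < t)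
    (hD : D.card * t ≤ 2 * n) (heavy : e / (8 * t) ≤ μ.real D) :
    (e / 4) ^ 2 / n ≤ e * avgMass μ D := by
  have hD' : ((D.card * t : ℕ) : ℝ) ≤ ((2 * n : ℕ) : ℝ) := by exact_mod_cast hD
  push_cast at hD'
  rcases Nat.eq_zero_or_pos n with rfl | hn
  · simpa using mul_nonneg he.le (avgMass_nonneg (μ := μ) (D := D))
  have le_avg : e ≤ 16 * n * avgMass μ D := by
    calc e ≤ 8 * t * μ.real D := (div_le_iff₀' (by positivity)).1 heavy
      _ = 8 * (D.card * t) * avgMass μ D := by rw [← card_mul_avgMass]; ring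
      _ ≤ 8 * (2 * n) * avgMass μ D := by
          gcongr
          exact avgMass_nonneg
      _ = _ := by ring
  rw [div_le_iff₀ (by positivity)]
  nlinarith

lemma abs_sub_avgMass_le_of_mixture {I : Segmentation n k} (hk : 0 < k) (he : 0 < e)
    (hq : q ∈ stdSimplex ℝ (Fin n)) (hr : r ∈ stdSimplex ℝ (Fin n)) (hI : I.IsFlatOn r)
    (hα : α ∈ Set.Icc (0 : ℝ) 1) (hD : D ∈ refinedDivision I q (e / 4))
    (card_le : D.card * (k * numBuckets n (e / 4)) ≤ 2 * n)
    (heavy : e / (8 * (k * numBuckets n (e / 4) : ℕ)) ≤ (distMeasure (mixture α q r)).real D) :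
    ∀ a ∈ D, |(distMeasure (mixture α q r)).real {a} - avgMass (distMeasure (mixture α q r)) D| ≤
      e * avgMass (distMeasure (mixture α q r)) D := by
  intro a ha
  have hp := mixture_mem_stdSimplex hq hr hα
  have := isProbabilityMeasure_distMeasure hp
  obtain ⟨i, j, -, bucket⟩ := exists_subset_of_mem_refinedDivision hD
  have tiny := le_mul_avgMass he (Nat.mul_pos hk (numBuckets_pos _ _)) card_le heavy
  simp only [avgMass, distMeasure_real_singleton hp.1] at tiny ⊢
  exact abs_mixture_sub_expect_mixture_le_mul (by positivity) (by linarith) hq.1 hr.1 hα bucket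
    (hI.eq_of_mem_refinedDivision hD) tiny ha

lemma accepts_of_coarseDist_le {I : Segmentation n k} {x : Fin (R * m) → Fin n} (hε : 0 < ε)
    (hq : q ∈ stdSimplex ℝ (Fin n)) (hr : r ∈ stdSimplex ℝ (Fin n)) (hI : I.IsFlatOn r)
    (hα : α ∈ Set.Icc (0 : ℝ) 1)
    (uniform : ∀ D ∈ refinedDivision I q (ε / 14 / 4),
      PassesUniformityTest (ε / 14) (k * numBuckets n (ε / 14 / 4)) x D)
    (close : coarseDist (refinedDivision I q (ε / 14 / 4)) (empirical x) (mixture α q r) ≤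
      ε / 14) :
    Accepts k ε q R m x := by
  have division := isDivision_refinedDivision I (by positivity : 0 < ε / 14 / 4) fun a ↦
    (mem_Icc_of_mem_stdSimplex hq a).2
  obtain ⟨β, hβ, lt⟩ :=
    division.exists_alphaGrid_coarseDist_lt (by positivity : 0 < ε / 14) hq hr hα close
  exact ⟨I, uniform, β, hβ, r, hr.1, hI, lt⟩

namespace SampleSizesSuffice

variable {I : Segmentation n k}

lemma measureReal_not_passesUniformityTest_mixture_le (hk : 0 < k) (he : 0 < e) (he' : e ≤ 1 / 7)
    (hq : q ∈ stdSimplex ℝ (Fin n)) (hr : r ∈ stdSimplex ℝ (Fin n)) (hI : I.IsFlatOn r)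
    (hα : α ∈ Set.Icc (0 : ℝ) 1)
    (h : SampleSizesSuffice n (k * numBuckets n (e / 4)) R m e δ)
    (hD : D ∈ refinedDivision I q (e / 4)) :
    (iid (Fin (R * m)) (distMeasure (mixture α q r))).real
      {x | ¬ PassesUniformityTest e (k * numBuckets n (e / 4)) x D} ≤ δ := by
  rcases le_or_gt D.card 1 with small | two_le
  · have passes :=
      passesUniformityTest_of_card_le_one he (Nat.mul_pos hk (numBuckets_pos n (e / 4))) h.pos
        small
    simpa only [passes, not_true_eq_false, Set.ofPred_false, measureReal_empty] using h.nonneg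
  · have := isProbabilityMeasure_distMeasure (mixture_mem_stdSimplex hq hr hα)
    obtain ⟨htn, card_le⟩ := lt_and_card_mul_le_of_mem_refinedDivision hk hD two_le
    exact h.measureReal_not_passesUniformityTest_le he he' htn two_le card_le
      (abs_sub_avgMass_le_of_mixture hk he hq hr hI hα hD card_le)

lemma measureReal_biUnion_not_passesUniformityTest_mixture_le (hk : 0 < k) (he : 0 < e)
    (he' : e ≤ 1 / 7) (hq : q ∈ stdSimplex ℝ (Fin n)) (hr : r ∈ stdSimplex ℝ (Fin n))
    (hI : I.IsFlatOn r) (hα : α ∈ Set.Icc (0 : ℝ) 1)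
    (h : SampleSizesSuffice n (k * numBuckets n (e / 4)) R m e δ) :
    (iid (Fin (R * m)) (distMeasure (mixture α q r))).real (⋃ D ∈ refinedDivision I q (e / 4),
      {x | ¬ PassesUniformityTest e (k * numBuckets n (e / 4)) x D}) ≤ (n ^ 2 + 1) * δ := by
  have := isProbabilityMeasure_distMeasure (mixture_mem_stdSimplex hq hr hα)
  refine (measureReal_biUnion_le_card_mul fun D hD ↦
    h.measureReal_not_passesUniformityTest_mixture_le hk he he' hq hr hI hα hD).trans ?_
  gcongr
  · exact h.nonneg
  · exact_mod_cast (Finset.card_le_card (refinedDivision_subset_runs I q (by positivity))).trans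
      (card_runs_le q (e / 4))

lemma measureReal_not_accepts_mixture_le (hk : 0 < k) (hε : 0 < ε) (hε2 : ε ≤ 2)
    (hq : q ∈ stdSimplex ℝ (Fin n)) (hr : r ∈ stdSimplex ℝ (Fin n)) (hI : I.IsFlatOn r)
    (hα : α ∈ Set.Icc (0 : ℝ) 1)
    (h : SampleSizesSuffice n (k * numBuckets n (ε / 14 / 4)) R m (ε / 14) δ) :
    (iid (Fin (R * m)) (distMeasure (mixture α q r))).real {x | ¬ Accepts k ε q R m x} ≤ 1 / 3 := by
  have hp := mixture_mem_stdSimplex hq hr hα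
  have := isProbabilityMeasure_distMeasure hp
  have he : 0 < ε / 14 := by positivity
  have uniform := h.measureReal_biUnion_not_passesUniformityTest_mixture_le hk he (by linarith) hq
    hr hI hα
  have shape := h.measureReal_lt_coarseDist_refinedDivision_le
    (μ := distMeasure (mixture α q r)) he.le (by positivity) (pos_of_mem_stdSimplex hq)
    fun a ↦ (mem_Icc_of_mem_stdSimplex hq a).2
  simp_rw [distMeasure_real_singleton hp.1] at shape
  refine (measureReal_mono fun x rejects ↦ ?_).trans <| (measureReal_union_le _ _).trans <|
    (add_le_add uniform shape).trans (by nlinarith [h.union_bound_le, h.nonneg])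
  by_contra good
  simp only [Set.mem_union, Set.mem_iUnion, Set.mem_ofPred_eq, not_or, not_exists, not_not,
    not_lt] at good
  exact rejects (accepts_of_coarseDist_le hε hq hr hI hα good.1 (good.2 I))

end SampleSizesSuffice

end Completeness

/-! ### Flattening -/

section Flattening

variable {ι : Type*} {f : ι → ℝ} {D : Finset ι}

/-- The `ℓ₁`-distance on `D` between `f` and the constant function with the same sum. Summed over
the sets of a division, it is the distance between `f` and its flattening. -/
def l1DistUniform (f : ι → ℝ) (D : Finset ι) : ℝ :=
  ∑ a ∈ D, |f a - 𝔼 b ∈ D, f b|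

lemma l1DistUniform_of_card_le_one (hD : D.card ≤ 1) : l1DistUniform f D = 0 := by
  refine Finset.sum_eq_zero fun a ha ↦ ?_
  rw [Finset.eq_singleton_iff_unique_mem.2 ⟨ha, fun b hb ↦ Finset.card_le_one.1 hD b hb a ha⟩,
    Finset.expect_singleton, sub_self, abs_zero]

lemma l1DistUniform_le_two_mul_sum (hf : 0 ≤ f) : l1DistUniform f D ≤ 2 * ∑ a ∈ D, f a := by
  have mean_nonneg : 0 ≤ 𝔼 b ∈ D, f b := Finset.expect_nonneg fun b _ ↦ hf b
  calc l1DistUniform f D ≤ ∑ a ∈ D, (f a + 𝔼 b ∈ D, f b) := Finset.sum_le_sum fun a _ ↦ by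
        simpa only [abs_of_nonneg (hf a), abs_of_nonneg mean_nonneg] using
          abs_sub (f a) (𝔼 b ∈ D, f b)
    _ = 2 * ∑ a ∈ D, f a := by
        rw [Finset.sum_add_distrib, Finset.sum_const, nsmul_eq_mul, Finset.card_mul_expect, two_mul]

lemma sq_l1DistUniform_le : l1DistUniform f D ^ 2 ≤ D.card * ∑ a ∈ D, (f a - 𝔼 b ∈ D, f b) ^ 2 := by
  simpa only [l1DistUniform, sq_abs] using
    sq_sum_le_card_mul_sum_sq (s := D) (f := fun a ↦ |f a - 𝔼 b ∈ D, f b|)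

lemma sum_abs_sub_le (f g : ι → ℝ) (D : Finset ι) : ∑ a ∈ D, |f a - g a| ≤
    l1DistUniform f D + |∑ a ∈ D, f a - ∑ a ∈ D, g a| + l1DistUniform g D := by
  calc ∑ a ∈ D, |f a - g a|
      ≤ ∑ a ∈ D, (|f a - 𝔼 b ∈ D, f b| + |𝔼 b ∈ D, f b - 𝔼 b ∈ D, g b| +
          |g a - 𝔼 b ∈ D, g b|) := by
        gcongr with a
        rw [abs_sub_comm (g a)]
        refine (abs_sub_le _ (𝔼 b ∈ D, g b) _).trans ?_
        gcongr
        exact abs_sub_le _ _ _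
    _ = _ := by
        rw [Finset.sum_add_distrib, Finset.sum_add_distrib, Finset.sum_const, nsmul_eq_mul,
          ← Nat.abs_cast, ← abs_mul, mul_sub, Finset.card_mul_expect, Finset.card_mul_expect]
        rfl

variable {n k t : ℕ} {e η α : ℝ} {μ : Measure (Fin n)} {q f : Fin n → ℝ} {D : Finset (Fin n)}
  {𝒟 : Finset (Finset (Fin n))}

lemma IsDivision.l1Dist_le (h𝒟 : IsDivision 𝒟) (f g : Fin n → ℝ) : l1Dist f g ≤
    ∑ D ∈ 𝒟, l1DistUniform f D + coarseDist 𝒟 f g + ∑ D ∈ 𝒟, l1DistUniform g D := by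
  rw [l1Dist, ← h𝒟.sum_sum, coarseDist, ← Finset.sum_add_distrib, ← Finset.sum_add_distrib]
  exact Finset.sum_le_sum fun D _ ↦ sum_abs_sub_le f g D

lemma l1DistUniform_le_mul_measureReal [IsFiniteMeasure μ] (he : 0 ≤ e)
    (near : sqDistUniform μ D ≤ 9 * e ^ 2 * (avgMass μ D * μ.real D)) :
    l1DistUniform (fun a ↦ μ.real {a}) D ≤ 3 * e * μ.real D := by
  refine le_of_sq_le_sq ?_ (by positivity)
  calc l1DistUniform (fun a ↦ μ.real {a}) D ^ 2 ≤ D.card * sqDistUniform μ D :=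
        sq_l1DistUniform_le
    _ ≤ D.card * (9 * e ^ 2 * (avgMass μ D * μ.real D)) := by gcongr
    _ = 9 * e ^ 2 * (D.card * avgMass μ D) * μ.real D := by ring
    _ = (3 * e * μ.real D) ^ 2 := by
        rw [card_mul_avgMass]
        ring

lemma IsDivision.sum_l1DistUniform_le [IsProbabilityMeasure μ] (h𝒟 : IsDivision 𝒟) (he : 0 ≤ e)
    (ht : 0 < t) (card_le : 𝒟.card ≤ 2 * t)
    (near : ∀ D ∈ 𝒟, 2 ≤ D.card → e / t ≤ μ.real D →
      sqDistUniform μ D ≤ 9 * e ^ 2 * (avgMass μ D * μ.real D)) :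
    ∑ D ∈ 𝒟, l1DistUniform (fun a ↦ μ.real {a}) D ≤ 7 * e := by
  have le_of_mem (D) (hD : D ∈ 𝒟) :
      l1DistUniform (fun a ↦ μ.real {a}) D ≤ 3 * e * μ.real D + 2 * (e / t) := by
    have : 0 ≤ 3 * e * μ.real D := by positivity
    have : 0 ≤ 2 * (e / t) := by positivity
    rcases le_or_gt D.card 1 with small | two_le
    · rw [l1DistUniform_of_card_le_one small]
      positivity
    rcases le_or_gt (e / t) (μ.real D) with heavy | light
    · linarith [l1DistUniform_le_mul_measureReal he (near D hD two_le heavy)]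
    · have le_two_mul := l1DistUniform_le_two_mul_sum (f := fun a ↦ μ.real {a}) (D := D)
        fun a ↦ measureReal_nonneg
      rw [sum_measureReal_singleton] at le_two_mul
      linarith
  calc ∑ D ∈ 𝒟, l1DistUniform (fun a ↦ μ.real {a}) D
      ≤ ∑ D ∈ 𝒟, (3 * e * μ.real D + 2 * (e / t)) := Finset.sum_le_sum le_of_mem
    _ = 3 * e + 𝒟.card * (2 * (e / t)) := by
        simp_rw [Finset.sum_add_distrib, ← Finset.mul_sum, ← sum_measureReal_singleton]
        rw [h𝒟.sum_sum, sum_measureReal_singleton, Finset.coe_univ, probReal_univ, mul_one,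
          Finset.sum_const, nsmul_eq_mul]
        ring
    _ ≤ 3 * e + (2 * t : ℕ) * (2 * (e / t)) := by gcongr
    _ = 7 * e := by
        push_cast
        field_simp
        ring

lemma sum_l1DistUniform_refinedDivision_le (I : Segmentation n k) (hη : 0 < η)
    (hq : q ∈ stdSimplex ℝ (Fin n)) :
    ∑ D ∈ refinedDivision I q η, l1DistUniform q D ≤ η ^ 2 + η := by
  have division := isDivision_refinedDivision I hη fun a ↦ (mem_Icc_of_mem_stdSimplex hq a).2
  have hn : (0 : ℝ) < n := by exact_mod_cast pos_of_mem_stdSimplex hq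
  have le_of_mem (D) (hD : D ∈ refinedDivision I q η) :
      l1DistUniform q D ≤ ∑ a ∈ D, (η ^ 2 / n + η * q a) := by
    obtain ⟨i, j, -, bucket⟩ := exists_subset_of_mem_refinedDivision hD
    have mean_nonneg : 0 ≤ η * 𝔼 b ∈ D, q b :=
      mul_nonneg hη.le (Finset.expect_nonneg fun b _ ↦ hq.1 b)
    calc l1DistUniform q D ≤ ∑ _a ∈ D, (η ^ 2 / n + η * 𝔼 b ∈ D, q b) :=
          Finset.sum_le_sum fun a ha ↦ (abs_sub_expect_le_of_subset_bucket hη hq.1 bucket ha).trans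
            (max_le_add_of_nonneg (by positivity) mean_nonneg)
      _ = ∑ a ∈ D, (η ^ 2 / n + η * q a) := by
          simp_rw [Finset.sum_add_distrib, ← Finset.mul_sum, Finset.sum_const, nsmul_eq_mul,
            Finset.card_mul_expect]
  calc _ ≤ ∑ D ∈ refinedDivision I q η, ∑ a ∈ D, (η ^ 2 / n + η * q a) :=
        Finset.sum_le_sum le_of_mem
    _ = η ^ 2 + η := by
        rw [division.sum_sum, Finset.sum_add_distrib, ← Finset.mul_sum, hq.2, Finset.sum_const,
          Finset.card_univ, Fintype.card_fin, nsmul_eq_mul, mul_div_cancel₀ _ hn.ne', mul_one]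

lemma l1DistUniform_mixture_le (hα : α ∈ Set.Icc (0 : ℝ) 1) (hf : ∀ a ∈ D, ∀ b ∈ D, f a = f b) :
    l1DistUniform (mixture α q f) D ≤ l1DistUniform q D :=
  Finset.sum_le_sum fun _ ha ↦ abs_mixture_sub_expect_mixture_le hα hf ha

end Flattening

/-! ### Soundness -/

section Soundness

variable {n k t R m : ℕ} {e ε δ α : ℝ} {μ : Measure (Fin n)} {q f g r : Fin n → ℝ}
  {D : Finset (Fin n)} {𝒟 : Finset (Finset (Fin n))} {I : Segmentation n k}

lemma exists_isFlatDist_l1Dist_eq (hn : 0 < n) (hf : 0 ≤ f) (hI : I.IsFlatOn f) :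
    ∃ r, IsFlatDist k r ∧ l1Dist f r = |∑ a, f a - 1| := by
  rcases (Finset.sum_nonneg fun a _ ↦ hf a : 0 ≤ ∑ a, f a).eq_or_lt with sum_eq | sum_pos
  · have f_eq : f = 0 := funext fun a ↦
      (Finset.sum_eq_zero_iff_of_nonneg fun a _ ↦ hf a).1 sum_eq.symm a (Finset.mem_univ a)
    have hn' : (n : ℝ) ≠ 0 := by positivity
    have sum_uniform : ∑ _a : Fin n, (1 / n : ℝ) = 1 := by simp [hn']
    refine ⟨fun _ ↦ 1 / n, ⟨⟨fun _ ↦ by positivity, sum_uniform⟩, I, fun _ _ _ _ _ ↦ rfl⟩, ?_⟩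
    simp [l1Dist, f_eq, hn']
  · have sum_normalized : ∑ a, f a / ∑ b, f b = 1 := by
      rw [← Finset.sum_div, div_self sum_pos.ne']
    refine ⟨fun a ↦ f a / ∑ b, f b, ⟨⟨fun a ↦ div_nonneg (hf a) sum_pos.le, sum_normalized⟩, I,
      fun i a ha b hb ↦ congrArg (· / _) (hI i a ha b hb)⟩, ?_⟩
    calc ∑ a, |f a - f a / ∑ b, f b| = ∑ a, f a / (∑ b, f b) * |∑ b, f b - 1| := by
          refine Finset.sum_congr rfl fun a _ ↦ ?_
          have : f a - f a / ∑ b, f b = f a / (∑ b, f b) * (∑ b, f b - 1) := by field_simp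
          rw [this, abs_mul, abs_of_nonneg (div_nonneg (hf a) sum_pos.le)]
      _ = |∑ a, f a - 1| := by rw [← Finset.sum_mul, sum_normalized, one_mul]

lemma l1Dist_triangle (f g h : Fin n → ℝ) : l1Dist f h ≤ l1Dist f g + l1Dist g h := by
  rw [l1Dist, l1Dist, l1Dist, ← Finset.sum_add_distrib]
  exact Finset.sum_le_sum fun a _ ↦ abs_sub_le _ _ _

lemma l1Dist_mixture_mixture (hα : 0 ≤ α) :
    l1Dist (mixture α q f) (mixture α q r) = α * l1Dist f r := by
  rw [l1Dist, l1Dist, Finset.mul_sum]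
  refine Finset.sum_congr rfl fun a _ ↦ ?_
  have : mixture α q f a - mixture α q r a = α * (f a - r a) := by
    rw [mixture, mixture]
    ring
  rw [this, abs_mul, abs_of_nonneg hα]

lemma IsDivision.mul_abs_sum_sub_one_le_coarseDist (h𝒟 : IsDivision 𝒟) (hα : 0 ≤ α)
    (hq : ∑ a, q a = 1) (hg : ∑ a, g a = 1) :
    α * |∑ a, f a - 1| ≤ coarseDist 𝒟 g (mixture α q f) := by
  refine le_of_eq_of_le ?_ (h𝒟.abs_sum_sub_sum_le_coarseDist g (mixture α q f))
  rw [← abs_of_nonneg hα, ← abs_mul, abs_of_nonneg hα, abs_sub_comm, hg]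
  simp_rw [mixture, Finset.sum_add_distrib, ← Finset.mul_sum, hq]
  ring_nf

lemma alphaGrid_subset_Icc (he : 0 ≤ e) : alphaGrid e ⊆ Set.Icc 0 1 := by
  rintro α (rfl | ⟨le_one, i, rfl⟩)
  · simp
  · exact ⟨by positivity, le_one⟩

lemma exists_isFlatDist_l1Dist_mixture_lt [IsProbabilityMeasure μ] (hk : 0 < k) (he : 0 < e)
    (he' : e ≤ 1 / 7) (hq : q ∈ stdSimplex ℝ (Fin n)) (hα : α ∈ Set.Icc (0 : ℝ) 1) (hf : 0 ≤ f)
    (hI : I.IsFlatOn f) (hg : ∑ a, g a = 1)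
    (near : ∀ D ∈ refinedDivision I q (e / 4), 2 ≤ D.card →
      e / (k * numBuckets n (e / 4) : ℕ) ≤ μ.real D →
      sqDistUniform μ D ≤ 9 * e ^ 2 * (avgMass μ D * μ.real D))
    (close : coarseDist (refinedDivision I q (e / 4)) g (fun a ↦ μ.real {a}) ≤ e)
    (close_mixture : coarseDist (refinedDivision I q (e / 4)) g (mixture α q f) < 2 * e) :
    ∃ r, IsFlatDist k r ∧ l1Dist (fun a ↦ μ.real {a}) (mixture α q r) < 14 * e := by
  set 𝒟 := refinedDivision I q (e / 4)
  set p : Fin n → ℝ := fun a ↦ μ.real {a}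
  have hn := pos_of_mem_stdSimplex hq
  have hη : 0 < e / 4 := by positivity
  have division : IsDivision 𝒟 :=
    isDivision_refinedDivision I hη fun a ↦ (mem_Icc_of_mem_stdSimplex hq a).2
  obtain ⟨r, hr, dist_eq⟩ := exists_isFlatDist_l1Dist_eq hn hf hI
  refine ⟨r, hr, ?_⟩
  have flattening_p : ∑ D ∈ 𝒟, l1DistUniform p D ≤ 7 * e :=
    division.sum_l1DistUniform_le he.le (Nat.mul_pos hk (numBuckets_pos _ _))
      (card_refinedDivision_le I q hn hη) near
  have flattening_mixture : ∑ D ∈ 𝒟, l1DistUniform (mixture α q f) D ≤ (e / 4) ^ 2 + e / 4 :=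
    (Finset.sum_le_sum fun D hD ↦ l1DistUniform_mixture_le hα
      (hI.eq_of_mem_refinedDivision hD)).trans (sum_l1DistUniform_refinedDivision_le I hη hq)
  have coarse : coarseDist 𝒟 p (mixture α q f) < 3 * e := by
    have := coarseDist_triangle 𝒟 p g (mixture α q f)
    rw [coarseDist_comm 𝒟 p g] at this
    linarith
  have normalization : l1Dist (mixture α q f) (mixture α q r) < 2 * e := by
    rw [l1Dist_mixture_mixture hα.1, dist_eq]
    exact (division.mul_abs_sum_sub_one_le_coarseDist hα.1 hq.2 hg).trans_lt close_mixture
  calc l1Dist p (mixture α q r)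
      ≤ l1Dist p (mixture α q f) + l1Dist (mixture α q f) (mixture α q r) :=
        l1Dist_triangle _ _ _
    _ < 14 * e := by nlinarith [division.l1Dist_le p (mixture α q f)]

lemma exists_lt_coarseDist_or_passes_of_accepts [IsProbabilityMeasure μ] {x : Fin (R * m) → Fin n}
    (hk : 0 < k) (hε : 0 < ε) (hε2 : ε ≤ 2) (hs : 0 < R * m) (hq : q ∈ stdSimplex ℝ (Fin n))
    (far : IsFarFromMixtures k ε q fun a ↦ μ.real {a}) (accepts : Accepts k ε q R m x) :
    ∃ I : Segmentation n k,
      ε / 14 < coarseDist (refinedDivision I q (ε / 14 / 4)) (empirical x) (fun a ↦ μ.real {a}) ∨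
      ∃ D ∈ refinedDivision I q (ε / 14 / 4), 2 ≤ D.card ∧
        ε / 14 / (k * numBuckets n (ε / 14 / 4) : ℕ) ≤ μ.real D ∧
        9 * (ε / 14) ^ 2 * (avgMass μ D * μ.real D) < sqDistUniform μ D ∧
        PassesUniformityTest (ε / 14) (k * numBuckets n (ε / 14 / 4)) x D := by
  obtain ⟨I, passes, α, hα, f, hf, hI, close_mixture⟩ := accepts
  replace hα := alphaGrid_subset_Icc (by positivity) hα
  refine ⟨I, ?_⟩
  by_contra! ⟨close, near⟩
  obtain ⟨r, hr, lt⟩ := exists_isFlatDist_l1Dist_mixture_lt hk (by positivity) (by linarith) hq hα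
    hf hI (sum_empirical_univ hs x)
    (fun D hD two_le heavy ↦ not_lt.1 fun not_near ↦
      near D hD two_le heavy not_near (passes D hD))
    close close_mixture
  exact (far r hr α hα).not_gt (by linarith)

lemma SampleSizesSuffice.measureReal_accepts_le [IsProbabilityMeasure μ] (hk : 0 < k) (hε : 0 < ε)
    (hε2 : ε ≤ 2) (hq : q ∈ stdSimplex ℝ (Fin n)) (far : IsFarFromMixtures k ε q fun a ↦ μ.real {a})
    (h : SampleSizesSuffice n (k * numBuckets n (ε / 14 / 4)) R m (ε / 14) δ) :
    (iid (Fin (R * m)) μ).real {x | Accepts k ε q R m x} ≤ 1 / 3 := by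
  set e := ε / 14 with he_def
  set t := k * numBuckets n (e / 4)
  set P := iid (Fin (R * m)) μ
  have he : 0 < e := by positivity
  have hη : 0 < e / 4 := by positivity
  set detectable := {D ∈ runs q (e / 4) | P.real {x | PassesUniformityTest e t x D} ≤ 2 * δ}
  have uniform : P.real (⋃ D ∈ detectable, {x | PassesUniformityTest e t x D}) ≤
      (n ^ 2 + 1) * (2 * δ) := by
    refine (measureReal_biUnion_le_card_mul fun D hD ↦ (Finset.mem_filter.1 hD).2).trans ?_
    gcongr
    · exact mul_nonneg zero_le_two h.nonneg
    · exact_mod_cast (Finset.card_filter_le _ _).trans (card_runs_le q (e / 4))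
  have shape := h.measureReal_lt_coarseDist_refinedDivision_le (μ := μ) he.le hη
    (pos_of_mem_stdSimplex hq) fun a ↦ (mem_Icc_of_mem_stdSimplex hq a).2
  refine (measureReal_mono fun x accepts ↦ ?_).trans <| (measureReal_union_le _ _).trans <|
    (add_le_add uniform shape).trans (by linarith [h.union_bound_le])
  obtain ⟨I, not_close | ⟨D, hD, two_le, heavy, not_near, passes⟩⟩ :=
    exists_lt_coarseDist_or_passes_of_accepts hk hε hε2 h.pos hq far accepts
  · exact Or.inr ⟨I, not_close⟩
  · obtain ⟨htn, card_le⟩ := lt_and_card_mul_le_of_mem_refinedDivision hk hD two_le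
    refine Or.inl (Set.mem_biUnion
      (Finset.mem_filter.2 ⟨refinedDivision_subset_runs I q hη hD, ?_⟩) passes)
    exact h.measureReal_passesUniformityTest_le he (by linarith) htn two_le card_le heavy
      not_near.le

end Soundness

/-! ### The number of samples -/

section SampleSizes

variable {n t R m : ℕ} {e ℓ : ℝ}

lemma one_third_pow_le_exp_neg {x : ℝ} (hx : x ≤ R) : (1 / 3 : ℝ) ^ R ≤ Real.exp (-x) := by
  calc (1 / 3 : ℝ) ^ R ≤ Real.exp (-1) ^ R := by
        gcongr
        rw [Real.exp_neg, ← one_div]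
        gcongr
        exact Real.exp_one_lt_three.le
    _ = Real.exp (-R) := by
        rw [← Real.exp_nat_mul, mul_neg_one]
    _ ≤ Real.exp (-x) := by gcongr

lemma one_le_sqrt_mul (hn : 0 < n) (ht : 0 < t) : 1 ≤ √((n : ℝ) * t) :=
  Real.one_le_sqrt.2 (by exact_mod_cast Nat.mul_pos hn ht)

lemma mul_sqrt_le_of_batchSize (ht : 0 < t) (hm : 160000 * √((n : ℝ) * t) ≤ m * e ^ 3) {d : ℝ}
    (hd : 0 ≤ d) (hdt : d * t ≤ 2 * n) : 10000 * √d ≤ m * (e / (8 * t)) * e ^ 2 := by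
  have sqrt_mul_le : √d * t ≤ 2 * √((n : ℝ) * t) := by
    rw [← Real.sqrt_sq (by positivity : (0 : ℝ) ≤ t), ← Real.sqrt_mul hd,
      Real.sqrt_sq (by positivity : (0 : ℝ) ≤ t)]
    refine Real.sqrt_le_left (by positivity) |>.2 ?_
    rw [mul_pow, Real.sq_sqrt (by positivity)]
    nlinarith [(Nat.cast_nonneg t : (0 : ℝ) ≤ t)]
  calc 10000 * √d = 80000 * (√d * t) / (8 * t) := by
        field_simp
        ring
    _ ≤ m * e ^ 3 / (8 * t) :=
        div_le_div_of_nonneg_right (by linarith) (by positivity)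
    _ = m * (e / (8 * t)) * e ^ 2 := by ring

lemma log_mul_sqrt_le (he : 0 < e) (he1 : e ≤ 1) (hR : 10 * ℓ ≤ R)
    (hm : 160000 * √((n : ℝ) * t) ≤ m * e ^ 3) {j : ℕ} (hj : j ≤ 3) :
    1600000 * (ℓ * √((n : ℝ) * t)) ≤ ((R * m : ℕ) : ℝ) * e ^ j := by
  calc 1600000 * (ℓ * √((n : ℝ) * t)) = 10 * ℓ * (160000 * √((n : ℝ) * t)) := by ring
    _ ≤ R * (m * e ^ 3) := mul_le_mul hR hm (by positivity) R.cast_nonneg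
    _ ≤ R * (m * e ^ j) := by
        gcongr R * (m * ?_)
        exact pow_le_pow_of_le_one he.le he1 hj
    _ = ((R * m : ℕ) : ℝ) * e ^ j := by
        push_cast
        ring

lemma exp_threshold_le_exp_neg (ht : 0 < t) (htn : t ≤ n) (he : 0 < e) (he1 : e ≤ 1) (hℓ : 0 ≤ ℓ)
    (hR : 10 * ℓ ≤ R) (hm : 160000 * √((n : ℝ) * t) ≤ m * e ^ 3) :
    Real.exp (-(e * ((R * m : ℕ) : ℝ) / (4 * t)) / 6) ≤ Real.exp (-(10 * ℓ)) := by
  have le_sqrt : (t : ℝ) ≤ √((n : ℝ) * t) := by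
    rw [Real.le_sqrt (by positivity) (by positivity), sq]
    gcongr
  have le_numSamples := log_mul_sqrt_le he he1 hR hm (j := 1) (by norm_num)
  have : 60 * ℓ ≤ e * ((R * m : ℕ) : ℝ) / (4 * t) := by
    rw [le_div_iff₀ (by positivity)]
    nlinarith
  gcongr
  linarith

lemma sq_add_one_pow_le_exp (hn : 0 < n) (hℓ : Real.log (2 * n) ≤ ℓ) (N : ℕ) :
    ((n : ℝ) ^ 2 + 1) ^ N ≤ Real.exp (N * (2 * ℓ)) := by
  have one_le : (1 : ℝ) ≤ n := by exact_mod_cast hn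
  rw [Real.exp_nat_mul]
  gcongr
  calc (n : ℝ) ^ 2 + 1 ≤ (2 * n) ^ 2 := by nlinarith
    _ = Real.exp (2 * Real.log (2 * n)) := by
        rw [two_mul (Real.log _), Real.exp_add, Real.exp_log (by positivity), sq]
    _ ≤ Real.exp (2 * ℓ) := by gcongr

lemma sq_add_one_pow_mul_exp_le (hn : 0 < n) (ht : 0 < t) (he : 0 < e) (he1 : e ≤ 1) (hℓ0 : 0 ≤ ℓ)
    (hℓ : Real.log (2 * n) ≤ ℓ) (hR : 10 * ℓ ≤ R) (hm : 160000 * √((n : ℝ) * t) ≤ m * e ^ 3)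
    {N : ℕ} (hNn : N ≤ n + 1) (hNt : N ≤ 2 * t) :
    ((n : ℝ) ^ 2 + 1) ^ N * Real.exp (-2 * ((R * m : ℕ) : ℝ) * (e / 2) ^ 2) ≤
      Real.exp (-(10 * ℓ)) := by
  have le_sqrt : (N : ℝ) ≤ 2 * √((n : ℝ) * t) := by
    refine le_of_sq_le_sq ?_ (by positivity)
    rw [mul_pow, Real.sq_sqrt (by positivity)]
    have : N * N ≤ (2 * n) * (2 * t) := Nat.mul_le_mul (by lia) hNt
    have : (N : ℝ) * N ≤ (2 * n) * (2 * t) := by exact_mod_cast this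
    linarith
  have le_numSamples := log_mul_sqrt_le he he1 hR hm (j := 2) (by norm_num)
  calc _ ≤ Real.exp (N * (2 * ℓ)) * Real.exp (-2 * ((R * m : ℕ) : ℝ) * (e / 2) ^ 2) := by
        gcongr
        exact sq_add_one_pow_le_exp hn hℓ N
    _ = Real.exp (N * (2 * ℓ) - ((R * m : ℕ) : ℝ) * e ^ 2 / 2) := by
        rw [← Real.exp_add]
        ring_nf
    _ ≤ Real.exp (-(10 * ℓ)) := by
        gcongr
        have := mul_le_mul_of_nonneg_left le_sqrt hℓ0
        have := mul_le_mul_of_nonneg_left (one_le_sqrt_mul hn ht) hℓ0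
        linarith

lemma two_mul_sq_add_three_mul_exp_neg_le (hn : 0 < n) (hℓ : Real.log (2 * n) ≤ ℓ) :
    (2 * (n : ℝ) ^ 2 + 3) * Real.exp (-(10 * ℓ)) ≤ 1 / 3 := by
  have one_le : (1 : ℝ) ≤ n := by exact_mod_cast hn
  have pow_le : (2 * n : ℝ) ^ 10 ≤ Real.exp (10 * ℓ) := by
    calc (2 * n : ℝ) ^ 10 = Real.exp ((10 : ℕ) * Real.log (2 * n)) := by
          rw [Real.exp_nat_mul, Real.exp_log (by positivity)]
      _ ≤ Real.exp (10 * ℓ) := by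
          push_cast
          gcongr
  rw [Real.exp_neg, ← div_eq_mul_inv, div_le_iff₀ (Real.exp_pos _)]
  calc 2 * (n : ℝ) ^ 2 + 3 ≤ 1 / 3 * (1024 * ((n : ℝ) ^ 2 * 1)) := by nlinarith
    _ ≤ 1 / 3 * (1024 * ((n : ℝ) ^ 2 * n ^ 8)) := by
        gcongr
        exact one_le_pow₀ one_le
    _ = 1 / 3 * (2 * n) ^ 10 := by ring
    _ ≤ 1 / 3 * Real.exp (10 * ℓ) := by gcongr

lemma sampleSizesSuffice_of_le (hn : 0 < n) (ht : 0 < t) (he : 0 < e) (he1 : e ≤ 1)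
    (hℓ : Real.log (2 * n) ≤ ℓ) (hR : 10 * ℓ ≤ R) (hm : 160000 * √((n : ℝ) * t) ≤ m * e ^ 3) :
    SampleSizesSuffice n t R m e (Real.exp (-(10 * ℓ))) := by
  have one_le : (1 : ℝ) ≤ n := by exact_mod_cast hn
  have ℓ_pos : 0 < ℓ := (Real.log_pos (by linarith)).trans_le hℓ
  have := one_pos.trans_le (one_le_sqrt_mul hn ht)
  have le_numSamples := log_mul_sqrt_le he he1 hR hm (Nat.zero_le 3)
  rw [pow_zero, mul_one] at le_numSamples
  exact {
    pos := Nat.cast_pos.1 ((by positivity : (0 : ℝ) < _).trans_le le_numSamples)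
    one_third_pow_le := one_third_pow_le_exp_neg hR
    exp_threshold_le htn := exp_threshold_le_exp_neg ht htn.le he he1 ℓ_pos.le hR hm
    le_batch_size d hd := mul_sqrt_le_of_batchSize ht hm d.cast_nonneg (by exact_mod_cast hd)
    pow_mul_exp_le _ hNn hNt := sq_add_one_pow_mul_exp_le hn ht he he1 ℓ_pos.le hℓ hR hm hNn hNt
    union_bound_le := two_mul_sq_add_three_mul_exp_neg_le hn hℓ }

end SampleSizes

section NumSamples

variable {n k : ℕ} {C ε η : ℝ}

lemma log_two_mul_le (hn : 0 < n) (hε : 0 < ε) (hε2 : ε ≤ 2) :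
    Real.log (2 * n) ≤ Real.log (4 * n / ε) := by
  gcongr
  rw [le_div_iff₀ hε]
  nlinarith [(Nat.cast_pos.2 hn : (0 : ℝ) < n)]

lemma half_le_log (hn : 0 < n) (hε : 0 < ε) (hε2 : ε ≤ 2) : 1 / 2 ≤ Real.log (4 * n / ε) := by
  have one_le : (1 : ℝ) ≤ n := by exact_mod_cast hn
  calc 1 / 2 ≤ Real.log 2 := by linarith [Real.log_two_gt_d9]
    _ ≤ Real.log (2 * n) := by
        gcongr
        linarith
    _ ≤ Real.log (4 * n / ε) := log_two_mul_le hn hε hε2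

lemma sampleSizesSuffice (hn : 0 < n) (hk : 0 < k) (hε : 0 < ε) (hε2 : ε ≤ 2) :
    SampleSizesSuffice n (k * numBuckets n (ε / 14 / 4)) (numBatches 10 n ε)
      (batchSize (10 ^ 9) n k ε) (ε / 14) (Real.exp (-(10 * Real.log (4 * n / ε)))) := by
  refine sampleSizesSuffice_of_le hn (Nat.mul_pos hk (numBuckets_pos _ _)) (by positivity)
    (by linarith) (log_two_mul_le hn hε hε2) (Nat.le_ceil _) ?_
  have le_batchSize : 10 ^ 9 * √((n : ℝ) * ((k * numBuckets n (ε / 14 / 4) : ℕ) : ℝ)) / ε ^ 3 ≤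
      batchSize (10 ^ 9) n k ε := Nat.le_ceil _
  rw [div_le_iff₀ (by positivity)] at le_batchSize
  linarith [Real.sqrt_nonneg ((n : ℝ) * ((k * numBuckets n (ε / 14 / 4) : ℕ) : ℝ))]

lemma half_le_log_one_add (hη : 0 ≤ η) (hη2 : η ≤ 2) : η / 2 ≤ Real.log (1 + η) := by
  refine le_trans ?_ (Real.le_log_one_add_of_nonneg hη)
  rw [div_le_div_iff₀ two_pos (by positivity)]
  nlinarith

lemma numBuckets_le (hn : 0 < n) (hη : 0 < η) (hη1 : η ≤ 1) :
    (numBuckets n η : ℝ) ≤ Real.log (n / η ^ 2) / (η / 2) + 2 := by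
  have one_le : (1 : ℝ) ≤ n := by exact_mod_cast hn
  have log_nonneg : 0 ≤ Real.log (n / η ^ 2) := by
    refine Real.log_nonneg ((one_le_div (by positivity)).2 ?_)
    nlinarith
  have half_le := half_le_log_one_add hη.le (by linarith)
  have ceil_lt := Nat.ceil_lt_add_one (div_nonneg log_nonneg ((half_pos hη).le.trans half_le))
  calc (numBuckets n η : ℝ) ≤ Real.log (n / η ^ 2) / Real.log (1 + η) + 2 := by
        rw [numBuckets]
        push_cast
        linarith
    _ ≤ Real.log (n / η ^ 2) / (η / 2) + 2 := by gcongr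

lemma log_div_sq_le (hn : 0 < n) (hε : 0 < ε) (hε2 : ε ≤ 2) :
    Real.log (n / (ε / 14 / 4) ^ 2) ≤ 10 * Real.log (4 * n / ε) := by
  have one_le : (1 : ℝ) ≤ n := by exact_mod_cast hn
  have two_le : 2 ≤ 4 * n / ε := by
    rw [le_div_iff₀ hε]
    nlinarith
  rw [← Nat.cast_ofNat (n := 10), ← Real.log_pow]
  gcongr
  calc (n : ℝ) / (ε / 14 / 4) ^ 2 ≤ n ^ 2 / (ε / 14 / 4) ^ 2 := by
        gcongr
        exact le_self_pow₀ one_le two_ne_zero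
    _ = 196 * (4 * n / ε) ^ 2 := by
        field_simp
        norm_num
    _ ≤ (4 * n / ε) ^ 8 * (4 * n / ε) ^ 2 := by
        gcongr
        exact (by norm_num : (196 : ℝ) ≤ 2 ^ 8).trans (by gcongr)
    _ = (4 * n / ε) ^ 10 := by ring

lemma numBuckets_le_mul_log (hn : 0 < n) (hε : 0 < ε) (hε2 : ε ≤ 2) :
    (numBuckets n (ε / 14 / 4) : ℝ) ≤ 1128 * Real.log (4 * n / ε) / ε := by
  calc (numBuckets n (ε / 14 / 4) : ℝ)
      ≤ Real.log (n / (ε / 14 / 4) ^ 2) / (ε / 14 / 4 / 2) + 2 :=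
        numBuckets_le hn (by positivity) (by linarith)
    _ ≤ 10 * Real.log (4 * n / ε) / (ε / 14 / 4 / 2) + 8 * Real.log (4 * n / ε) / ε := by
        gcongr
        · exact log_div_sq_le hn hε hε2
        · rw [le_div_iff₀ hε]
          linarith [half_le_log hn hε hε2]
    _ = 1128 * Real.log (4 * n / ε) / ε := by ring

lemma sqrt_mul_numBuckets_le (hn : 0 < n) (hε : 0 < ε) (hε2 : ε ≤ 2) :
    √((n : ℝ) * ((k * numBuckets n (ε / 14 / 4) : ℕ) : ℝ)) ≤
      √((n : ℝ) * k) * (68 * Real.log (4 * n / ε) / √ε) := by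
  have half_le := half_le_log hn hε hε2
  calc _ ≤ √(n * k * (1128 * Real.log (4 * n / ε) / ε)) := by
        push_cast
        rw [← mul_assoc]
        gcongr
        exact numBuckets_le_mul_log hn hε hε2
    _ = √((n : ℝ) * k) * (√(1128 * Real.log (4 * n / ε)) / √ε) := by
        rw [Real.sqrt_mul (by positivity), Real.sqrt_div (by positivity)]
    _ ≤ _ := by
        gcongr
        rw [Real.sqrt_le_left (by positivity)]
        nlinarith

lemma numBatches_le (hn : 0 < n) (hε : 0 < ε) (hε2 : ε ≤ 2) (hC : 0 ≤ C) :
    (numBatches C n ε : ℝ) ≤ (C + 2) * Real.log (4 * n / ε) := by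
  have half_le := half_le_log hn hε hε2
  have := Nat.ceil_lt_add_one (mul_nonneg hC (one_half_pos.le.trans half_le))
  rw [numBatches]
  linarith

lemma batchSize_le (hn : 0 < n) (hk : 0 < k) (hε : 0 < ε) (hε2 : ε ≤ 2) (hC : 0 ≤ C) :
    (batchSize C n k ε : ℝ) ≤
      (C + 8) * √((n : ℝ) * ((k * numBuckets n (ε / 14 / 4) : ℕ) : ℝ)) / ε ^ 3 := by
  have one_le := one_le_sqrt_mul hn (Nat.mul_pos hk (numBuckets_pos n (ε / 14 / 4)))
  have pow_le : ε ^ 3 ≤ 2 ^ 3 := by gcongr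
  rw [batchSize]
  set w := √((n : ℝ) * ((k * numBuckets n (ε / 14 / 4) : ℕ) : ℝ))
  calc (⌈C * w / ε ^ 3⌉₊ : ℝ) ≤ C * w / ε ^ 3 + 1 := (Nat.ceil_lt_add_one (by positivity)).le
    _ ≤ C * w / ε ^ 3 + 8 * w / ε ^ 3 := by
        gcongr
        rw [one_le_div (by positivity)]
        linarith
    _ = (C + 8) * w / ε ^ 3 := by ring

lemma numSamples_le (hn : 0 < n) (hk : 0 < k) (hε : 0 < ε) (hε2 : ε ≤ 2) :
    ((numBatches 10 n ε * batchSize (10 ^ 9) n k ε : ℕ) : ℝ) ≤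
      10 ^ 12 * (√((n : ℝ) * k) / ε ^ (3.5 : ℝ)) * Real.log (4 * n / ε) ^ 2 := by
  have half_le := half_le_log hn hε hε2
  have rpow_eq : ε ^ (3.5 : ℝ) = ε ^ 3 * √ε := by
    rw [Real.sqrt_eq_rpow, ← Real.rpow_natCast, ← Real.rpow_add hε]
    norm_num
  rw [rpow_eq]
  set ℓ := Real.log (4 * n / ε)
  calc ((numBatches 10 n ε * batchSize (10 ^ 9) n k ε : ℕ) : ℝ)
      ≤ (10 + 2) * ℓ * ((10 ^ 9 + 8) * (√((n : ℝ) * k) * (68 * ℓ / √ε)) / ε ^ 3) := by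
        push_cast
        gcongr
        · exact numBatches_le hn hε hε2 (by norm_num)
        · refine (batchSize_le hn hk hε hε2 (by norm_num)).trans ?_
          gcongr
          exact sqrt_mul_numBuckets_le hn hε hε2
    _ = 12 * (10 ^ 9 + 8) * 68 * (√((n : ℝ) * k) / (ε ^ 3 * √ε)) * ℓ ^ 2 := by
        field_simp
        norm_num
    _ ≤ 10 ^ 12 * (√((n : ℝ) * k) / (ε ^ 3 * √ε)) * ℓ ^ 2 := by
        gcongr
        norm_num

lemma two_thirds_le_sampleProb {p : Fin n → ℝ} {s : ℕ} {E : (Fin s → Fin n) → Prop}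
    (hp : p ∈ stdSimplex ℝ (Fin n)) (h : (iid (Fin s) (distMeasure p)).real {x | ¬E x} ≤ 1 / 3) :
    2 / 3 ≤ sampleProb p s E := by
  have := isProbabilityMeasure_distMeasure hp
  have compl_eq : {x | ¬E x} = {x | E x}ᶜ := rfl
  rw [compl_eq, probReal_compl_eq_one_sub (Set.toFinite _).measurableSet] at h
  rw [sampleProb_eq_iid_real hp.1]
  linarith

end NumSamples

end KFlat

end

theorem mainTheorem4 :
    ∃ (C₁ C₂ C : ℝ) (c : ℕ), 0 < C₁ ∧ 0 < C₂ ∧ 0 < C ∧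
      ∀ (n k : ℕ) (ε : ℝ) (q : Fin n → ℝ), 1 ≤ k → 0 < ε → ε ≤ 2 →
        q ∈ stdSimplex ℝ (Fin n) →
        (((KFlat.numBatches C₁ n ε * KFlat.batchSize C₂ n k ε : ℕ) : ℝ) ≤
          C * (√((n : ℝ) * k) / ε ^ (3.5 : ℝ)) * Real.log (4 * n / ε) ^ c) ∧
        KFlat.IsFlatNoiseIdentityTester k ε q
          (KFlat.numBatches C₁ n ε * KFlat.batchSize C₂ n k ε)
          (KFlat.Accepts k ε q (KFlat.numBatches C₁ n ε) (KFlat.batchSize C₂ n k ε)) := by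
  refine ⟨10, 10 ^ 9, 10 ^ 12, 2, by norm_num, by norm_num, by norm_num,
    fun n k ε q hk hε hε2 hq ↦ ?_⟩
  have hn := KFlat.pos_of_mem_stdSimplex hq
  have sizes := KFlat.sampleSizesSuffice hn hk hε hε2
  refine ⟨KFlat.numSamples_le hn hk hε hε2, fun p hp ↦ ⟨?_, fun far ↦ ?_⟩⟩
  · rintro ⟨r, ⟨hr, I, hI⟩, α, hα, rfl⟩
    exact KFlat.two_thirds_le_sampleProb hp
      (KFlat.SampleSizesSuffice.measureReal_not_accepts_mixture_le hk hε hε2 hq hr hI hα sizes)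
  · have := KFlat.isProbabilityMeasure_distMeasure hp
    refine KFlat.two_thirds_le_sampleProb hp ?_
    simp_rw [not_not]
    refine sizes.measureReal_accepts_le hk hε hε2 hq ?_
    simpa only [KFlat.distMeasure_real_singleton hp.1] using far
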